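/- Let $n\ge 1$, $a\ge 1$ and $s_0>0$. Let $\phi:\mathbb{R}^n\to\mathbb{R}$ be smooth on $\mathbb{R}^n\setminus\{0\}$ and positively homogeneous of degree $a$, i.e. $\phi(r\xi)=r^a\phi(\xi)$ for all $r>0$ and $\xi\neq 0$. Suppose that for every multi-index $\alpha$ there is a constant $C_\alpha$ with $$|\partial^\alpha\phi(\xi)|\le C_\alpha|\xi|^{a-|\alpha|}\quad(\xi\ne 0),\qquad\text{and that}\qquad \min_{|\xi|=1}|\nabla\phi(\xi)|>0.$$ For a (complex-valued) Schwartz function $f\in\mathcal{S}(\mathbb{R}^n)$ and $t\in\mathbb{R}$ put $$T_tf(x)=\int_{\mathbb{R}^n}e^{ix\cdot\xi+it\phi(\xi)}\,\widehat f(\xi)\,d\xi,\qquad \widehat f(\xi)=\int_{\mathbb{R}^n}e^{-ix\cdot\xi}f(x)\,dx,$$ and $\|f\|_{H^s(\mathbb{R}^n)}=\|(1+|\xi|^2)^{s/2}\widehat f(\xi)\|_{L^2(\mathbb{R}^n)}$. Suppose that for every $s>s_0$ there is a finite constant $C$ such that $$\Big\|\sup_{0<t<1}|T_tf|\Big\|_{L^2(B(0,1))}\le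 C\,\|f\|_{H^s(\mathbb{R}^n)}\qquad\text{for all } f\in\mathcal{S}(\mathbb{R}^n).$$ Then for every $s>as_0$ there is a finite constant $C'$ such that $$\Big\|\sup_{0<t<1}|T_tf|\Big\|_{L^2(\mathbb{R}^n)}\le C'\,\|f\|_{H^s(\mathbb{R}^n)}\qquad\text{for all } f\in\mathcal{S}(\mathbb{R}^n).$$ -/

import Mathlib

open MeasureTheory Set
open scoped SchwartzMap NNReal ENNReal ContDiff RealInnerProductSpace

noncomputable section

namespace MaximalTransference

/-- The Fourier transform `f̂(ξ) = ∫ e^{-i x·ξ} f(x) dx` on `ℝⁿ`, without a factor `2π` in the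
exponent. -/
def hat {n : ℕ} (f : 𝓢(EuclideanSpace ℝ (Fin n), ℂ)) (ξ : EuclideanSpace ℝ (Fin n)) : ℂ :=
  ∫ x, Complex.exp (-(Complex.I * ((⟪x, ξ⟫ : ℝ) : ℂ))) * f x

/-- `T_t f(x) = ∫ e^{i x·ξ + i t φ(ξ)} f̂(ξ) dξ`. -/
def T {n : ℕ} (φ : EuclideanSpace ℝ (Fin n) → ℝ) (t : ℝ)
    (f : 𝓢(EuclideanSpace ℝ (Fin n), ℂ)) (x : EuclideanSpace ℝ (Fin n)) : ℂ :=
  ∫ ξ, Complex.exp (Complex.I * ((⟪x, ξ⟫ : ℝ) : ℂ) + Complex.I * ((t * φ ξ : ℝ) : ℂ)) * hat f ξ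

/-- The maximal function `sup_{0<t<1} |T_t f(x)|`, with values in `[0, ∞]`. -/
def maximalFn {n : ℕ} (φ : EuclideanSpace ℝ (Fin n) → ℝ)
    (f : 𝓢(EuclideanSpace ℝ (Fin n), ℂ)) (x : EuclideanSpace ℝ (Fin n)) : ℝ≥0∞ :=
  ⨆ t ∈ Ioo (0 : ℝ) 1, ‖T φ t f x‖ₑ

/-- The norm `‖f‖_{H^s} = ‖⟨ξ⟩^s f̂(ξ)‖_{L²}` with `⟨ξ⟩ = (1 + |ξ|²)^{1/2}`. -/
def sobolevNorm {n : ℕ} (s : ℝ) (f : 𝓢(EuclideanSpace ℝ (Fin n), ℂ)) : ℝ≥0∞ :=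
  eLpNorm (fun ξ : EuclideanSpace ℝ (Fin n) => ((√(1 + ‖ξ‖ ^ 2) ^ s : ℝ) : ℂ) * hat f ξ) 2 volume

/-- The partial derivative `∂_{i 0} ∂_{i 1} ⋯ ∂_{i (k-1)} φ(ξ)` of order `k`. As `k` and `i` vary,
these are all the derivatives `∂^α φ` with a multi-index `α` (and `|α| = k`). -/
def partialDeriv {n k : ℕ} (i : Fin k → Fin n) (φ : EuclideanSpace ℝ (Fin n) → ℝ)
    (ξ : EuclideanSpace ℝ (Fin n)) : ℝ :=
  iteratedFDeriv ℝ k φ ξ (fun j => EuclideanSpace.single (i j) (1 : ℝ))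

/-- The estimate `‖sup_{0<t<1} |T_t f|‖_{L²(U)} ≤ C ‖f‖_{H^s}` for all Schwartz functions `f`,
with a finite constant `C` that does not depend on `f`. -/
def MaximalEstimate {n : ℕ} (φ : EuclideanSpace ℝ (Fin n) → ℝ)
    (U : Set (EuclideanSpace ℝ (Fin n))) (s : ℝ) : Prop :=
  ∃ C : ℝ≥0, ∀ f : 𝓢(EuclideanSpace ℝ (Fin n), ℂ),
    eLpNorm (maximalFn φ f) 2 (volume.restrict U) ≤ (C : ℝ≥0∞) * sobolevNorm s f

end MaximalTransference

end

set_option linter.unusedSectionVars false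

noncomputable section

namespace MaximalTransference

open Filter Topology FourierTransform

/-! ### `L²` tools: Minkowski for series, dilations, Plancherel. -/

section General

variable {E : Type*} [NormedAddCommGroup E] [InnerProductSpace ℝ E] [FiniteDimensional ℝ E]
  [MeasurableSpace E] [BorelSpace E]

/-! At frequency `|ξ| ~ μ ≥ 1`, restrict to times `t < μ^(1-a) ≤ 1`. By homogeneity the phase `t
μ^(1-a) φ(ξ)` is `t μ φ(ξ/μ)`, whose gradient is `O(1)` on the frequency support, so in this time
range waves travel a distance `O(1)`. The local hypothesis therefore sees everything: the bound `C
μ^s ‖g‖₂` on the unit ball (`MaximalEstimate.localBound`) extends to all of space with the same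
power of `μ`.

The extension needs no kernel estimates. Multiplication by a coordinate commutes with the multiplier
up to a derivative of the symbol, and that derivative is a combination of symbols of the same type
with bounded coefficients (`fderiv_phaseSymbol`). Hence the local bound survives multiplication by
`(1+|x|²)^M`, which puts a decaying weight on the right-hand side (`LocalBound.weighted`).
Translating and integrating over all centres gives `LocalBound.global`.

Being global, the estimate can be dilated: with `μ = N^a` and dilation factor `N^(a-1)`, it becomes
a bound for the full time interval at frequency `N`, with constant `(N^a)^s = N^(as)`
(`LocalBound.rescaled`). This is the source of the loss from `s₀` to `a s₀`. For larger `s` the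
dyadic pieces sum geometrically; low frequencies are handled by the power series of the exponential
(`exists_global_bound`). -/

theorem eLpNorm_two_sq {α ε : Type*} [MeasurableSpace α] [TopologicalSpace ε]
    [ContinuousENorm ε] (f : α → ε) (μ : Measure α) :
    eLpNorm f 2 μ ^ 2 = ∫⁻ x, ‖f x‖ₑ ^ 2 ∂μ := by
  have h := eLpNorm_nnreal_pow_eq_lintegral (μ := μ) (f := f) (p := 2) (by norm_num)
  simpa using h

theorem eLpNorm_two_const_mul {α : Type*} [MeasurableSpace α] (μ : Measure α) {c : ℝ≥0∞}
    (hc : c ≠ ⊤) (F : α → ℝ≥0∞) :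
    eLpNorm (fun x => c * F x) 2 μ = c * eLpNorm F 2 μ := by
  rw [← (ENNReal.pow_right_strictMono two_ne_zero).injective.eq_iff, mul_pow, eLpNorm_two_sq,
    eLpNorm_two_sq]
  simp only [enorm_eq_self, mul_pow]
  exact lintegral_const_mul' _ _ (ENNReal.pow_ne_top hc)

/-- Minkowski's inequality for countable sums of nonnegative functions. -/
theorem eLpNorm_two_tsum_le {α : Type*} [MeasurableSpace α] {μ : Measure α}
    {h : ℕ → α → ℝ≥0∞} (hm : ∀ j, Measurable (h j)) :
    eLpNorm (fun x => ∑' j, h j x) 2 μ ≤ ∑' j, eLpNorm (h j) 2 μ := by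
  rw [← ENNReal.pow_le_pow_left_iff two_ne_zero, eLpNorm_two_sq]
  have hlim : Tendsto (fun N : ℕ => ∫⁻ x, ‖∑ j ∈ Finset.range N, h j x‖ₑ ^ 2 ∂μ) atTop
      (𝓝 (∫⁻ x, ‖∑' j, h j x‖ₑ ^ 2 ∂μ)) := by
    apply lintegral_tendsto_of_tendsto_of_monotone
    · intro N
      have := Finset.measurable_fun_sum (Finset.range N) (fun j _ => hm j)
      exact (by simpa using this.pow_const 2 : Measurable _).aemeasurable
    · refine ae_of_all _ fun x M N hMN => ?_
      simp only [enorm_eq_self]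
      gcongr
    · refine ae_of_all _ fun x => ?_
      simp only [enorm_eq_self]
      exact (ENNReal.continuous_pow 2).continuousAt.tendsto.comp
        ENNReal.summable.hasSum.tendsto_sum_nat
  refine le_of_tendsto' hlim fun N => ?_
  rw [← eLpNorm_two_sq]
  gcongr
  have := eLpNorm_sum_le (μ := μ) (p := 2) (f := h) (s := Finset.range N)
    (fun i _ => (hm i).aestronglyMeasurable) (by norm_num)
  refine le_trans ?_ (this.trans (ENNReal.sum_le_tsum _))
  refine le_of_eq ?_
  congr 1
  ext x
  simp

theorem eLpNorm_two_comp_smul {ε : Type*} [TopologicalSpace ε] [ContinuousENorm ε]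
    (f : E → ε) {c : ℝ} (hc : 0 < c) :
    eLpNorm (fun x => f (c • x)) 2 volume
      = ENNReal.ofReal (c ^ (-(Module.finrank ℝ E : ℝ) / 2)) * eLpNorm f 2 volume := by
  have he : MeasurableEmbedding (fun x : E => c • x) :=
    (Homeomorph.smulOfNeZero c hc.ne').measurableEmbedding
  have h := he.eLpNorm_map_measure (μ := volume) (g := f) (p := 2)
  rw [Measure.map_addHaar_smul _ hc.ne', eLpNorm_smul_measure_of_ne_top (by norm_num)] at h
  rw [← Function.comp_def f, ← h, smul_eq_mul]
  congr 1
  rw [abs_of_pos (by positivity), ENNReal.ofReal_rpow_of_pos (by positivity)]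
  congr 1
  rw [← Real.rpow_natCast, ← Real.rpow_neg hc.le, ← Real.rpow_mul hc.le]
  congr 1
  simp; ring

theorem eLpNorm_fourier (f : 𝓢(E, ℂ)) :
    eLpNorm (𝓕 f : 𝓢(E, ℂ)) 2 volume = eLpNorm f 2 volume := by
  have h : ((eLpNorm (𝓕 f : 𝓢(E, ℂ)) 2 volume).toReal : ℝ) = (eLpNorm f 2 volume).toReal :=
    (SchwartzMap.norm_toLp (f := (𝓕 f : 𝓢(E, ℂ))) (p := 2)).symm.trans
      ((SchwartzMap.norm_fourier_toL2_eq f).trans SchwartzMap.norm_toLp)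
  have h1 (g : 𝓢(E, ℂ)) : eLpNorm g 2 volume ≠ ⊤ := (g.memLp 2 volume).2.ne
  exact (ENNReal.toReal_eq_toReal_iff' (h1 _) (h1 _)).1 h

theorem continuous_fourierInv {F : E → ℂ} (h1 : Integrable F) : Continuous (𝓕⁻ F : E → ℂ) := by
  rw [Real.fourierInv_eq_fourier_comp_neg]
  exact VectorFourier.fourierIntegral_continuous Real.continuous_fourierChar
    (L := innerₗ E) continuous_inner h1.comp_neg

/-- Plancherel's theorem on `L¹ ∩ L²`. -/
theorem eLpNorm_fourierInv {F : E → ℂ} (h1 : Integrable F) (h2 : MemLp F 2) :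
    eLpNorm (𝓕⁻ F : E → ℂ) 2 volume = eLpNorm F 2 volume := by
  -- The `L²` extension of the inverse transform and the integral formula agree as distributions:
  -- both move onto the test function by duality.
  have key : (𝓕⁻ (h2.toLp F) : Lp ℂ 2 (volume : Measure E)) =ᵐ[volume] (𝓕⁻ F : E → ℂ) := by
    apply ae_eq_of_integral_contDiff_smul_eq
      ((Lp.memLp _).locallyIntegrable (by norm_num)) (continuous_fourierInv h1).locallyIntegrable
    intro g hg hgs
    let G : 𝓢(E, ℂ) := HasCompactSupport.toSchwartzMap (f := fun x => (g x : ℂ))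
      (hgs.comp_left (g := Complex.ofReal) (by simp)) (Complex.ofRealCLM.contDiff.comp hg)
    have e := congrArg (fun u => u G)
      (MeasureTheory.Lp.fourierInv_toTemperedDistribution_eq (h2.toLp F))
    simp only [TemperedDistribution.fourierInv_apply, Lp.toTemperedDistribution_apply] at e
    have e2 : ∫ x, (𝓕⁻ F : E → ℂ) x • G x = ∫ x, F x • (𝓕⁻ (G : E → ℂ)) x := by
      have := VectorFourier.integral_fourierIntegral_smul_eq_flip (μ := volume) (ν := volume)
        (L := -innerₗ E) Real.continuous_fourierChar (by
          simpa [Pi.neg_def] using! continuous_inner.neg)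
        h1 G.integrable
      rw [show (-innerₗ E).flip = -innerₗ E by ext; simp [real_inner_comm]] at this
      exact this
    simp only [← SchwartzMap.fourierInv_coe] at e2
    have e3 : ∫ x, (𝓕⁻ G : 𝓢(E, ℂ)) x • (h2.toLp F : E → ℂ) x
        = ∫ x, (𝓕⁻ G : 𝓢(E, ℂ)) x • F x := by
      refine integral_congr_ae ?_
      filter_upwards [h2.coeFn_toLp] with x hx
      rw [hx]
    rw [e3] at e
    simp only [smul_eq_mul, mul_comm (F _)] at e2 e
    rw [← e2] at e
    have hG (u : ℂ) (x : E) : g x • u = u * G x := by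
      change g x • u = u * (g x : ℂ)
      simp [mul_comm]
    simp only [hG]
    simp only [mul_comm (G _)] at e
    exact e.symm
  have h3 : ‖(𝓕⁻ (h2.toLp F) : Lp ℂ 2 (volume : Measure E))‖ = ‖h2.toLp F‖ := by
    rw [← Lp.norm_fourier_eq, fourier_fourierInv_eq]
  rw [← eLpNorm_congr_ae key, ← eLpNorm_congr_ae h2.coeFn_toLp]
  exact (ENNReal.toReal_eq_toReal_iff' (Lp.memLp _).2.ne (Lp.memLp _).2.ne).1 h3

end General

/-! ### Fourier multipliers and their symmetries: translation, dilation, multiplication by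
coordinates. -/

section Multiplier

variable {E : Type*} [NormedAddCommGroup E] [InnerProductSpace ℝ E] [FiniteDimensional ℝ E]
  [MeasurableSpace E] [BorelSpace E]

/-- The Fourier multiplier operator with symbol `b`. -/
def multiplier (b : E → ℂ) (g : 𝓢(E, ℂ)) : E → ℂ := 𝓕⁻ (fun ξ => b ξ * (𝓕 g : 𝓢(E, ℂ)) ξ)

/-- Bounded measurable symbols. -/
def BoundedSymbol (b : E → ℂ) : Prop := Measurable b ∧ ∃ C : ℝ, ∀ ξ, ‖b ξ‖ ≤ C

namespace BoundedSymbol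

theorem integrable {b : E → ℂ} (hb : BoundedSymbol b) (g : 𝓢(E, ℂ)) :
    Integrable (fun ξ => b ξ * g ξ) := by
  obtain ⟨C, hC⟩ := hb.2
  exact g.integrable.bdd_mul hb.1.aestronglyMeasurable (ae_of_all _ hC)

theorem memLp {b : E → ℂ} (hb : BoundedSymbol b) (g : 𝓢(E, ℂ)) :
    MemLp (fun ξ => b ξ * g ξ) 2 := by
  obtain ⟨C, hC⟩ := hb.2
  refine (g.memLp 2 volume).of_le_mul (c := C)
    (hb.1.aestronglyMeasurable.mul g.continuous.aestronglyMeasurable) (ae_of_all _ fun ξ => ?_)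
  rw [norm_mul]
  gcongr
  exact hC ξ

theorem mul {b c : E → ℂ} (hb : BoundedSymbol b) (hc : BoundedSymbol c) :
    BoundedSymbol (fun ξ => b ξ * c ξ) := by
  obtain ⟨C, hC⟩ := hb.2
  obtain ⟨D, hD⟩ := hc.2
  refine ⟨hb.1.mul hc.1, C * D, fun ξ => ?_⟩
  rw [norm_mul]
  exact mul_le_mul (hC ξ) (hD ξ) (norm_nonneg _) ((norm_nonneg _).trans (hC ξ))

theorem const_mul {b : E → ℂ} (hb : BoundedSymbol b) (c : ℂ) :
    BoundedSymbol (fun ξ => c * b ξ) :=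
  BoundedSymbol.mul (b := fun _ => c) ⟨measurable_const, ‖c‖, fun _ => le_rfl⟩ hb

theorem add {b c : E → ℂ} (hb : BoundedSymbol b) (hc : BoundedSymbol c) :
    BoundedSymbol (fun ξ => b ξ + c ξ) := by
  obtain ⟨C, hC⟩ := hb.2
  obtain ⟨D, hD⟩ := hc.2
  exact ⟨hb.1.add hc.1, C + D, fun ξ => (norm_add_le _ _).trans (add_le_add (hC ξ) (hD ξ))⟩

theorem comp_smul {b : E → ℂ} (hb : BoundedSymbol b) (c : ℝ) :
    BoundedSymbol (fun ξ => b (c • ξ)) :=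
  ⟨hb.1.comp (measurable_const_smul c), hb.2.imp fun _ h _ => h _⟩

theorem continuous_multiplier {b : E → ℂ} (hb : BoundedSymbol b) (g : 𝓢(E, ℂ)) :
    Continuous (multiplier b g) :=
  continuous_fourierInv (hb.integrable _)

theorem eLpNorm_multiplier {b : E → ℂ} (hb : BoundedSymbol b) (g : 𝓢(E, ℂ)) :
    eLpNorm (multiplier b g) 2 volume
      = eLpNorm (fun ξ => b ξ * (𝓕 g : 𝓢(E, ℂ)) ξ) 2 volume :=
  eLpNorm_fourierInv (hb.integrable _) (hb.memLp _)

end BoundedSymbol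

theorem multiplier_apply (b : E → ℂ) (g : 𝓢(E, ℂ)) (x : E) :
    multiplier b g x = ∫ ξ, Complex.exp (↑(2 * Real.pi * ⟪ξ, x⟫) * Complex.I) *
      (b ξ * (𝓕 g : 𝓢(E, ℂ)) ξ) := by
  simp [multiplier, Real.fourierInv_eq']

theorem integrable_exp_mul {F : E → ℂ} (hF : Integrable F) (x : E) :
    Integrable (fun ξ => Complex.exp (↑(2 * Real.pi * ⟪ξ, x⟫) * Complex.I) * F ξ) := by
  refine hF.bdd_mul (c := 1) (by fun_prop) (ae_of_all _ fun ξ => ?_)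
  rw [Complex.norm_exp_ofReal_mul_I]

theorem multiplier_add_symbol {b c : E → ℂ} (hb : BoundedSymbol b) (hc : BoundedSymbol c)
    (g : 𝓢(E, ℂ)) (x : E) :
    multiplier (fun ξ => b ξ + c ξ) g x = multiplier b g x + multiplier c g x := by
  simp only [multiplier_apply]
  rw [← integral_add (integrable_exp_mul (hb.integrable _) x)
    (integrable_exp_mul (hc.integrable _) x)]
  congr 1
  ext ξ
  ring

theorem multiplier_const_mul (c : ℂ) (b : E → ℂ) (g : 𝓢(E, ℂ)) (x : E) :
    multiplier (fun ξ => c * b ξ) g x = c * multiplier b g x := by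
  simp only [multiplier_apply]
  rw [← integral_const_mul]
  congr 1
  ext ξ
  ring

theorem multiplier_add {b : E → ℂ} (hb : BoundedSymbol b) (g h : 𝓢(E, ℂ)) (x : E) :
    multiplier b (g + h) x = multiplier b g x + multiplier b h x := by
  simp only [multiplier_apply]
  rw [← integral_add (integrable_exp_mul (hb.integrable _) x)
    (integrable_exp_mul (hb.integrable _) x)]
  congr 1
  ext ξ
  rw [FourierAdd.fourier_add, add_apply]
  ring

theorem multiplier_fourierMultiplierCLM (b : E → ℂ) {m : E → ℂ} (hm : m.HasTemperateGrowth)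
    (g : 𝓢(E, ℂ)) :
    multiplier b (SchwartzMap.fourierMultiplierCLM ℂ m g) = multiplier (fun ξ => b ξ * m ξ) g := by
  unfold multiplier
  congr 1
  ext ξ
  simp [SchwartzMap.fourierMultiplierCLM_apply, SchwartzMap.smulLeftCLM_apply_apply hm, mul_assoc]

theorem fourier_translate (g : 𝓢(E, ℂ)) (y ξ : E) :
    (𝓕 (SchwartzMap.compSubConstCLM ℂ (-y) g) : 𝓢(E, ℂ)) ξ =
      Complex.exp (↑(2 * Real.pi * ⟪ξ, y⟫) * Complex.I) * (𝓕 g : 𝓢(E, ℂ)) ξ := by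
  rw [SchwartzMap.fourier_coe, SchwartzMap.fourier_coe]
  have h : (⇑(SchwartzMap.compSubConstCLM ℂ (-y) g) : E → ℂ) = g ∘ (fun v => v + y) := by
    ext v; simp
  rw [h]
  have := congrFun (VectorFourier.fourierIntegral_comp_add_right Real.fourierChar
    (volume : Measure E) (innerₗ E) g y) ξ
  refine this.trans ?_
  simp only [innerₗ_apply_apply, Circle.smul_def, Real.fourierChar_apply, smul_eq_mul,
    real_inner_comm]
  rfl

theorem multiplier_translate (b : E → ℂ) (g : 𝓢(E, ℂ)) (x y : E) :
    multiplier b (SchwartzMap.compSubConstCLM ℂ (-y) g) x = multiplier b g (x + y) := by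
  simp only [multiplier_apply, fourier_translate]
  congr 1
  ext ξ
  rw [inner_add_right, mul_add, Complex.ofReal_add, add_mul, Complex.exp_add]
  ring

/-- Dilation `g ↦ g(c ·)` on Schwartz functions. -/
def dilate (c : ℝ) (hc : c ≠ 0) : 𝓢(E, ℂ) →L[ℂ] 𝓢(E, ℂ) :=
  SchwartzMap.compCLMOfContinuousLinearEquiv ℂ (ContinuousLinearEquiv.smulLeft (Units.mk0 c hc))

theorem dilate_apply {c : ℝ} (hc : c ≠ 0) (g : 𝓢(E, ℂ)) (x : E) : dilate c hc g x = g (c • x) := by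
  simp [dilate, Units.smul_def]

theorem fourier_dilate {c : ℝ} (hc : 0 < c) (g : 𝓢(E, ℂ)) (ξ : E) :
    (𝓕 (dilate c hc.ne' g) : 𝓢(E, ℂ)) (c • ξ) =
      (c ^ Module.finrank ℝ E)⁻¹ • (𝓕 g : 𝓢(E, ℂ)) ξ := by
  rw [SchwartzMap.fourier_coe, SchwartzMap.fourier_coe, Real.fourier_eq', Real.fourier_eq']
  have := Measure.integral_comp_smul (volume : Measure E)
    (fun v => Complex.exp (↑(-2 * Real.pi * ⟪v, ξ⟫) * Complex.I) • g v) c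
  rw [abs_of_pos (by positivity)] at this
  rw [← this]
  congr 1
  ext v
  rw [dilate_apply, inner_smul_left, inner_smul_right]
  simp

theorem multiplier_dilate (b : E → ℂ) {c : ℝ} (hc : 0 < c) (g : 𝓢(E, ℂ)) (x : E) :
    multiplier b (dilate c hc.ne' g) x = multiplier (fun ξ => b (c • ξ)) g (c • x) := by
  simp only [multiplier_apply]
  have := Measure.integral_comp_smul (volume : Measure E)
    (fun ξ => Complex.exp (↑(2 * Real.pi * ⟪ξ, x⟫) * Complex.I) *
      (b ξ * (𝓕 (dilate c hc.ne' g) : 𝓢(E, ℂ)) ξ)) c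
  rw [abs_of_pos (by positivity), eq_inv_smul_iff₀ (by positivity)] at this
  rw [← this, ← integral_smul]
  congr 1
  ext ξ
  rw [fourier_dilate hc, real_inner_smul_left, real_inner_smul_right]
  simp only [Complex.real_smul]
  have : ((c ^ Module.finrank ℝ E : ℝ) : ℂ) ≠ 0 := by exact_mod_cast (by positivity)
  push_cast at this ⊢
  field_simp

/-- Multiplication by the linear function `⟪·, v⟫`. -/
def mulInner (v : E) (g : 𝓢(E, ℂ)) : 𝓢(E, ℂ) := SchwartzMap.smulLeftCLM ℂ (inner ℝ · v) g

theorem mulInner_apply (v : E) (g : 𝓢(E, ℂ)) (x : E) : mulInner v g x = ⟪x, v⟫ * g x := by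
  have : (inner ℝ · v : E → ℝ).HasTemperateGrowth := by fun_prop
  simp [mulInner, SchwartzMap.smulLeftCLM_apply_apply this]

-- Multiplication by `⟪·, v⟫` is, up to the factor `2πi`, a derivative in frequency. The product
-- rule for `b · 𝓕 g` produces the commutator term with `∂_v b`.
open LineDeriv in
theorem multiplier_mulInner {b : E → ℂ} (hb : ContDiff ℝ ∞ b) (hb' : HasCompactSupport b) (v : E)
    (g : 𝓢(E, ℂ)) (x : E) :
    multiplier b (mulInner v g) x = ⟪x, v⟫ * multiplier b g x +
      (2 * Real.pi * Complex.I)⁻¹ * multiplier (fun ξ => fderiv ℝ b ξ v) g x := by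
  have hbt : b.HasTemperateGrowth := hb'.hasTemperateGrowth hb
  have hit : (inner ℝ · v : E → ℝ).HasTemperateGrowth := by fun_prop
  set H : 𝓢(E, ℂ) := 𝓕 g with hH
  set G : 𝓢(E, ℂ) := SchwartzMap.smulLeftCLM ℂ b H with hG
  have hpi : (2 * Real.pi * Complex.I : ℂ) ≠ 0 := Complex.two_pi_I_ne_zero
  have hGcoe : (G : E → ℂ) = fun ξ => b ξ * H ξ := by
    ext ξ; simp [hG, SchwartzMap.smulLeftCLM_apply_apply hbt]
  have hdG (ξ : E) : (∂_{v} G) ξ = fderiv ℝ b ξ v * H ξ + b ξ * (∂_{v} H) ξ := by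
    rw [SchwartzMap.lineDerivOp_apply_eq_fderiv, SchwartzMap.lineDerivOp_apply_eq_fderiv, hGcoe,
      fderiv_fun_mul (hb.differentiable (by simp) ξ) H.differentiableAt]
    simp
    ring
  have hdH (ξ : E) : (∂_{v} H) ξ
      = -(2 * Real.pi * Complex.I) * (𝓕 (mulInner v g) : 𝓢(E, ℂ)) ξ := by
    rw [hH, SchwartzMap.lineDerivOp_fourier_eq, FourierTransform.fourier_smul]
    rfl
  have hkey (ξ : E) : b ξ * (𝓕 (mulInner v g) : 𝓢(E, ℂ)) ξ =
      -(2 * Real.pi * Complex.I)⁻¹ * (∂_{v} G) ξ +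
      (2 * Real.pi * Complex.I)⁻¹ * (fderiv ℝ b ξ v * H ξ) := by
    rw [hdG, hdH]
    field_simp
    ring
  have hdb : BoundedSymbol (fun ξ => fderiv ℝ b ξ v) := by
    have hc : Continuous (fun ξ => fderiv ℝ b ξ v) :=
      (hb.continuous_fderiv (by simp)).clm_apply continuous_const
    obtain ⟨C, hC⟩ := (hb'.fderiv_apply (𝕜 := ℝ) v).exists_bound_of_continuous hc
    exact ⟨hc.measurable, C, hC⟩
  have hinv : (𝓕⁻ (∂_{v} G) : 𝓢(E, ℂ)) x
      = -(2 * Real.pi * Complex.I) * (⟪x, v⟫ * multiplier b g x) := by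
    rw [SchwartzMap.fourierInv_lineDerivOp_eq]
    have : (𝓕⁻ G : 𝓢(E, ℂ)) x = multiplier b g x := by
      rw [SchwartzMap.fourierInv_coe, hGcoe]; rfl
    simp [SchwartzMap.smulLeftCLM_apply_apply hit, this]
  rw [SchwartzMap.fourierInv_coe, Real.fourierInv_eq'] at hinv
  have hsplit : multiplier b (mulInner v g) x = -(2 * Real.pi * Complex.I)⁻¹ *
        (∫ ξ, Complex.exp (↑(2 * Real.pi * ⟪ξ, x⟫) * Complex.I) • (∂_{v} G) ξ) +
      (2 * Real.pi * Complex.I)⁻¹ * multiplier (fun ξ => fderiv ℝ b ξ v) g x := by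
    simp only [multiplier_apply, hkey, smul_eq_mul]
    rw [← integral_const_mul, ← integral_const_mul, ← integral_add]
    · congr 1
      ext ξ
      ring
    · exact (integrable_exp_mul (∂_{v} G).integrable x).const_mul _
    · exact (integrable_exp_mul (hdb.integrable _) x).const_mul _
  rw [hsplit, hinv]
  field_simp

/-- The maximal operator attached to a family of symbols. -/
def maxOp (b : ℝ → E → ℂ) (g : 𝓢(E, ℂ)) (x : E) : ℝ≥0∞ :=
  ⨆ t ∈ Ioo (0 : ℝ) 1, ‖multiplier (b t) g x‖ₑ

theorem le_maxOp (b : ℝ → E → ℂ) (g : 𝓢(E, ℂ)) (x : E) {t : ℝ} (ht : t ∈ Ioo (0 : ℝ) 1) :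
    ‖multiplier (b t) g x‖ₑ ≤ maxOp b g x :=
  le_iSup₂ (f := fun t (_ : t ∈ Ioo (0 : ℝ) 1) => ‖multiplier (b t) g x‖ₑ) t ht

theorem measurable_maxOp {b : ℝ → E → ℂ} (hb : ∀ t, BoundedSymbol (b t)) (g : 𝓢(E, ℂ)) :
    Measurable (maxOp b g) :=
  (lowerSemicontinuous_biSup fun t _ =>
    ((hb t).continuous_multiplier g).enorm.lowerSemicontinuous).measurable

end Multiplier

/-! ### Frequency-localised symbols and the stability of local bounds under coordinate weights. -/

section Cutoff

variable {E : Type*} [NormedAddCommGroup E] [InnerProductSpace ℝ E] [FiniteDimensional ℝ E]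
  [MeasurableSpace E] [BorelSpace E]

/-- Smooth compactly supported functions that vanish near the origin. -/
structure IsCutoff (m : E → ℂ) : Prop where
  contDiff : ContDiff ℝ ∞ m
  hasCompactSupport : HasCompactSupport m
  eventually_eq_zero : ∀ᶠ ξ in 𝓝 0, m ξ = 0

namespace IsCutoff

variable {m : E → ℂ}

/-- A cutoff is zero near the origin, so it absorbs factors that may be singular there, such as `ψ`
and its derivatives. -/
theorem mul_left (hm : IsCutoff m) {F : E → ℂ} (hF : ContDiffOn ℝ ∞ F {0}ᶜ) :
    IsCutoff (fun ξ => F ξ * m ξ) where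
  contDiff := by
    rw [contDiff_iff_contDiffAt]
    intro ξ
    rcases eq_or_ne ξ 0 with rfl | hξ
    · refine (contDiffAt_const (c := (0 : ℂ))).congr_of_eventuallyEq ?_
      filter_upwards [hm.eventually_eq_zero] with η hη
      simp [hη]
    · exact (hF.contDiffAt (isOpen_compl_singleton.mem_nhds hξ)).mul hm.contDiff.contDiffAt
  hasCompactSupport := hm.hasCompactSupport.mul_left
  eventually_eq_zero := by
    filter_upwards [hm.eventually_eq_zero] with η hη
    simp [hη]

theorem fderiv_apply (hm : IsCutoff m) (v : E) : IsCutoff (fun ξ => fderiv ℝ m ξ v) where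
  contDiff := (hm.contDiff.fderiv_right (m := ∞) (by simp)).clm_apply contDiff_const
  hasCompactSupport := hm.hasCompactSupport.fderiv_apply (𝕜 := ℝ) v
  eventually_eq_zero := by
    filter_upwards [eventually_eventually_nhds.2 hm.eventually_eq_zero] with η hη
    have : m =ᶠ[𝓝 η] fun _ => 0 := hη
    simp [this.fderiv_eq]

theorem comp_smul (hm : IsCutoff m) {c : ℝ} (hc : c ≠ 0) : IsCutoff (fun ξ => m (c • ξ)) where
  contDiff := hm.contDiff.comp (contDiff_const_smul c)
  hasCompactSupport := hm.hasCompactSupport.comp_smul hc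
  eventually_eq_zero := by
    have : Tendsto (fun ξ : E => c • ξ) (𝓝 0) (𝓝 0) := by
      simpa using (continuous_const_smul c).tendsto (0 : E)
    exact this.eventually hm.eventually_eq_zero

theorem boundedSymbol (hm : IsCutoff m) : BoundedSymbol m := by
  obtain ⟨C, hC⟩ := hm.hasCompactSupport.exists_bound_of_continuous hm.contDiff.continuous
  exact ⟨hm.contDiff.continuous.measurable, C, hC⟩

theorem hasTemperateGrowth (hm : IsCutoff m) : m.HasTemperateGrowth :=
  hm.hasCompactSupport.hasTemperateGrowth hm.contDiff

end IsCutoff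

/-- The symbol `e^{i t μ ψ(ξ/μ)} m(ξ/μ)`. -/
def phaseSymbol (ψ : E → ℝ) (m : E → ℂ) (μ t : ℝ) (ξ : E) : ℂ :=
  Complex.exp (Complex.I * ((t * μ * ψ (μ⁻¹ • ξ) : ℝ) : ℂ)) * m (μ⁻¹ • ξ)

variable {ψ : E → ℝ} {m : E → ℂ} {μ : ℝ}

theorem contDiffOn_exp (hψ : ContDiffOn ℝ ∞ ψ {0}ᶜ) (c : ℝ) :
    ContDiffOn ℝ ∞ (fun ξ => Complex.exp (Complex.I * ((c * ψ ξ : ℝ) : ℂ))) {0}ᶜ :=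
  (contDiffOn_const.mul
    (Complex.ofRealCLM.contDiff.comp_contDiffOn (contDiffOn_const.mul hψ))).cexp

theorem isCutoff_phaseSymbol (hψ : ContDiffOn ℝ ∞ ψ {0}ᶜ) (hm : IsCutoff m) (hμ : 0 < μ) (t : ℝ) :
    IsCutoff (phaseSymbol ψ m μ t) :=
  (hm.mul_left (contDiffOn_exp hψ (t * μ))).comp_smul (inv_ne_zero hμ.ne')

theorem isCutoff_fderiv_mul (hψ : ContDiffOn ℝ ∞ ψ {0}ᶜ) (hm : IsCutoff m) (v : E) :
    IsCutoff (fun ξ => (fderiv ℝ ψ ξ v : ℂ) * m ξ) :=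
  hm.mul_left (Complex.ofRealCLM.contDiff.comp_contDiffOn
    ((hψ.fderiv_of_isOpen isOpen_compl_singleton (by simp)).clm_apply contDiffOn_const))

/-- The factor `μ` in the phase cancels the `μ⁻¹` of the chain rule. The result consists of two
phase symbols with new cutoffs, whose coefficients are at most `1` in modulus for `0 < t < 1` and `μ
≥ 1`. -/
theorem fderiv_phaseSymbol (hψ : ContDiffOn ℝ ∞ ψ {0}ᶜ) (hm : IsCutoff m) (hμ : 0 < μ) (t : ℝ)
    (ξ v : E) :
    fderiv ℝ (phaseSymbol ψ m μ t) ξ v =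
      Complex.I * t * phaseSymbol ψ (fun ξ => (fderiv ℝ ψ ξ v : ℂ) * m ξ) μ t ξ +
      ((μ⁻¹ : ℝ) : ℂ) * phaseSymbol ψ (fun ξ => fderiv ℝ m ξ v) μ t ξ := by
  have h := fderiv_comp_smul (𝕜 := ℝ) μ⁻¹ (x := ξ)
    (f := fun ζ => Complex.exp (Complex.I * ((t * μ * ψ ζ : ℝ) : ℂ)) * m ζ)
  have h' : fderiv ℝ (phaseSymbol ψ m μ t) ξ = _ := h
  rw [h']
  simp only [phaseSymbol]
  generalize μ⁻¹ • ξ = ζ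
  rcases eq_or_ne ζ 0 with rfl | hζ
  · have h1 : m =ᶠ[𝓝 0] fun _ => 0 := hm.eventually_eq_zero
    have h2 : (fun ζ => Complex.exp (Complex.I * ((t * μ * ψ ζ : ℝ) : ℂ)) * m ζ)
        =ᶠ[𝓝 0] fun _ => 0 := by
      filter_upwards [h1] with η hη
      simp [hη]
    have h3 := h1.eq_of_nhds
    simp only [_root_.smul_apply, h1.fderiv_eq, h2.fderiv_eq, h3]
    simp
  · have d1 : DifferentiableAt ℝ ψ ζ :=
      (hψ.contDiffAt (isOpen_compl_singleton.mem_nhds hζ)).differentiableAt (by simp)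
    have d2 : HasFDerivAt (fun ζ => Complex.exp (Complex.I * ((t * μ * ψ ζ : ℝ) : ℂ))) _ ζ :=
      ((Complex.ofRealCLM.hasFDerivAt.comp ζ (d1.hasFDerivAt.const_mul (t * μ))).const_mul
        Complex.I).cexp
    have d3 := (hm.contDiff.differentiable (by simp) ζ).hasFDerivAt
    have d4 : HasFDerivAt
      (fun ζ => Complex.exp (Complex.I * ((t * μ * ψ ζ : ℝ) : ℂ)) * m ζ) _ ζ := d2.mul d3
    rw [d4.fderiv]
    have hμ' : (μ : ℂ) ≠ 0 := by exact_mod_cast hμ.ne'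
    simp
    field_simp
    ring

/-- The maximal estimate on the unit ball for frequencies comparable to `μ ≥ 1`, for the functions
`A g`. -/
def LocalBound (ψ : E → ℝ) (s : ℝ) (A : 𝓢(E, ℂ) → 𝓢(E, ℂ)) : Prop :=
  ∀ m, IsCutoff m → ∃ C : ℝ≥0, ∀ μ : ℝ, 1 ≤ μ → ∀ g : 𝓢(E, ℂ),
    eLpNorm (maxOp (phaseSymbol ψ m μ) (A g)) 2 (volume.restrict (Metric.ball 0 1))
      ≤ C * ENNReal.ofReal (μ ^ s) * eLpNorm g 2 volume

theorem LocalBound.add (hψ : ContDiffOn ℝ ∞ ψ {0}ᶜ) {s : ℝ} {A B : 𝓢(E, ℂ) → 𝓢(E, ℂ)}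
    (hA : LocalBound ψ s A) (hB : LocalBound ψ s B) : LocalBound ψ s (fun g => A g + B g) := by
  intro m hm
  obtain ⟨C, hC⟩ := hA m hm
  obtain ⟨D, hD⟩ := hB m hm
  refine ⟨C + D, fun μ hμ g => ?_⟩
  have hb (t : ℝ) := (isCutoff_phaseSymbol hψ hm (zero_lt_one.trans_le hμ) t).boundedSymbol
  push_cast
  rw [add_mul, add_mul]
  refine le_trans ?_ (add_le_add (hC μ hμ g) (hD μ hμ g))
  refine le_trans (eLpNorm_mono_enorm fun x => ?_) (eLpNorm_add_le
    (measurable_maxOp hb _).aestronglyMeasurable (measurable_maxOp hb _).aestronglyMeasurable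
    (by norm_num))
  simp only [enorm_eq_self, Pi.add_apply]
  refine iSup₂_le fun t ht => ?_
  rw [multiplier_add (hb t)]
  exact (enorm_add_le _ _).trans (add_le_add (le_maxOp _ _ _ ht) (le_maxOp _ _ _ ht))

/-- On the unit ball `|⟪x, v⟫| ≤ ‖v‖`, and the commutator terms are controlled by the bound for `A`
with two other cutoffs. This is why `LocalBound` quantifies over all cutoffs. Measuring `g` rather
than `A g` on the right lets the step be iterated. -/
theorem LocalBound.mulInner (hψ : ContDiffOn ℝ ∞ ψ {0}ᶜ) {s : ℝ} {A : 𝓢(E, ℂ) → 𝓢(E, ℂ)}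
    (hA : LocalBound ψ s A) (v : E) :
    LocalBound ψ s (fun g => MaximalTransference.mulInner v (A g)) := by
  intro m hm
  have hm1 := isCutoff_fderiv_mul hψ hm v
  have hm2 := hm.fderiv_apply v
  obtain ⟨C₀, hC₀⟩ := hA m hm
  obtain ⟨C₁, hC₁⟩ := hA _ hm1
  obtain ⟨C₂, hC₂⟩ := hA _ hm2
  refine ⟨‖v‖₊ * C₀ + (C₁ + C₂), fun μ hμ g => ?_⟩
  have hμ0 := zero_lt_one.trans_le hμ
  have hb (t : ℝ) := (isCutoff_phaseSymbol hψ hm hμ0 t).boundedSymbol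
  have hb1 (t : ℝ) := (isCutoff_phaseSymbol hψ hm1 hμ0 t).boundedSymbol
  have hb2 (t : ℝ) := (isCutoff_phaseSymbol hψ hm2 hμ0 t).boundedSymbol
  set F₀ := maxOp (phaseSymbol ψ m μ) (A g)
  set F₁ := maxOp (phaseSymbol ψ (fun ξ => (fderiv ℝ ψ ξ v : ℂ) * m ξ) μ) (A g)
  set F₂ := maxOp (phaseSymbol ψ (fun ξ => fderiv ℝ m ξ v) μ) (A g)
  have hpt (x : E) (hx : x ∈ Metric.ball (0 : E) 1) :
      maxOp (phaseSymbol ψ m μ) (MaximalTransference.mulInner v (A g)) x ≤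
        ‖v‖ₑ * F₀ x + (F₁ x + F₂ x) := by
    refine iSup₂_le fun t ht => ?_
    have hcut := isCutoff_phaseSymbol hψ hm hμ0 t
    rw [multiplier_mulInner hcut.contDiff hcut.hasCompactSupport]
    simp only [fderiv_phaseSymbol hψ hm hμ0]
    rw [multiplier_add_symbol ((hb1 t).const_mul _) ((hb2 t).const_mul _),
      multiplier_const_mul, multiplier_const_mul, mul_add]
    have h2pi : ‖(2 * Real.pi * Complex.I : ℂ)⁻¹‖ ≤ 1 := by
      rw [norm_inv]
      apply inv_le_one_of_one_le₀
      simp [abs_of_pos Real.pi_pos]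
      linarith [Real.pi_gt_three]
    have e1 : ‖(2 * Real.pi * Complex.I : ℂ)⁻¹ * (Complex.I * t)‖ₑ ≤ 1 := by
      rw [← ofReal_norm, ENNReal.ofReal_le_one, norm_mul]
      refine mul_le_one₀ h2pi (norm_nonneg _) ?_
      simpa [abs_of_pos ht.1] using ht.2.le
    have e2 : ‖(2 * Real.pi * Complex.I : ℂ)⁻¹ * ((μ⁻¹ : ℝ) : ℂ)‖ₑ ≤ 1 := by
      rw [← ofReal_norm, ENNReal.ofReal_le_one, norm_mul]
      refine mul_le_one₀ h2pi (norm_nonneg _) ?_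
      rw [Complex.norm_real, Real.norm_of_nonneg (by positivity)]
      exact inv_le_one_of_one_le₀ hμ
    have e0 : ‖((⟪x, v⟫ : ℝ) : ℂ)‖ₑ ≤ ‖v‖ₑ := by
      rw [← ofReal_norm, ← ofReal_norm]
      apply ENNReal.ofReal_le_ofReal
      rw [Complex.norm_real]
      refine (norm_inner_le_norm _ _).trans ?_
      have : ‖x‖ ≤ 1 := by simpa using (mem_ball_zero_iff.1 hx).le
      nlinarith [norm_nonneg v]
    rw [← mul_assoc, ← mul_assoc _ _ (multiplier (phaseSymbol ψ (fun ξ => fderiv ℝ m ξ v) μ t) _ x)]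
    refine (enorm_add_le _ _).trans (add_le_add ?_ ((enorm_add_le _ _).trans (add_le_add ?_ ?_)))
    · rw [enorm_mul]
      exact mul_le_mul' e0 (le_maxOp _ _ _ ht)
    · rw [enorm_mul]
      exact (mul_le_mul' e1 (le_maxOp _ _ _ ht)).trans_eq (one_mul _)
    · rw [enorm_mul]
      exact (mul_le_mul' e2 (le_maxOp _ _ _ ht)).trans_eq (one_mul _)
  have hF₀ : Measurable F₀ := measurable_maxOp hb _
  have hF₁ : Measurable F₁ := measurable_maxOp hb1 _
  have hF₂ : Measurable F₂ := measurable_maxOp hb2 _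
  set ν := (volume : Measure E).restrict (Metric.ball 0 1)
  calc eLpNorm (maxOp (phaseSymbol ψ m μ) (MaximalTransference.mulInner v (A g))) 2 ν
      ≤ eLpNorm ((fun x => ‖v‖ₑ * F₀ x) + (F₁ + F₂)) 2 ν := by
        refine eLpNorm_mono_enorm_ae ?_
        filter_upwards [ae_restrict_mem Metric.isOpen_ball.measurableSet] with x hx
        simpa using hpt x hx
    _ ≤ ‖v‖ₑ * eLpNorm F₀ 2 ν + (eLpNorm F₁ 2 ν + eLpNorm F₂ 2 ν) := by
        refine (eLpNorm_add_le (hF₀.const_mul _).aestronglyMeasurable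
          (hF₁.add hF₂).aestronglyMeasurable (by norm_num)).trans (add_le_add ?_ ?_)
        · exact (eLpNorm_two_const_mul ν enorm_ne_top F₀).le
        · exact eLpNorm_add_le hF₁.aestronglyMeasurable hF₂.aestronglyMeasurable (by norm_num)
    _ ≤ _ := by
        push_cast
        rw [add_mul, add_mul, add_mul, add_mul, mul_assoc (‖v‖₊ : ℝ≥0∞), mul_assoc (‖v‖₊ : ℝ≥0∞)]
        exact add_le_add (mul_le_mul' le_rfl (hC₀ μ hμ g))
          (add_le_add (hC₁ μ hμ g) (hC₂ μ hμ g))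

end Cutoff

/-! ### From the unit ball to the whole space, then to unit time. -/

section Globalization

variable {E : Type*} [NormedAddCommGroup E] [InnerProductSpace ℝ E] [FiniteDimensional ℝ E]
  [MeasurableSpace E] [BorelSpace E] {ψ : E → ℝ} {m : E → ℂ} {s : ℝ}

/-- Multiplication by `1 + |x|²`. -/
def mulBracketSq (g : 𝓢(E, ℂ)) : 𝓢(E, ℂ) :=
  g + ∑ i, mulInner (stdOrthonormalBasis ℝ E i) (mulInner (stdOrthonormalBasis ℝ E i) g)

theorem mulBracketSq_apply (g : 𝓢(E, ℂ)) (x : E) :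
    mulBracketSq g x = ((1 + ‖x‖ ^ 2 : ℝ) : ℂ) * g x := by
  rw [mulBracketSq, add_apply, sum_apply]
  simp only [mulInner_apply, ← mul_assoc]
  rw [← Finset.sum_mul, ← (stdOrthonormalBasis ℝ E).sum_sq_inner_left x]
  push_cast
  rw [add_mul, one_mul]
  congr 2
  exact Finset.sum_congr rfl fun i _ => by rw [pow_two]

theorem LocalBound.mulBracketSq (hψ : ContDiffOn ℝ ∞ ψ {0}ᶜ) {A : 𝓢(E, ℂ) → 𝓢(E, ℂ)}
    (hA : LocalBound ψ s A) : LocalBound ψ s (fun g => MaximalTransference.mulBracketSq (A g)) := by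
  unfold MaximalTransference.mulBracketSq
  -- Induction on the set of coordinates needs the claim for all partial sums `1 + ∑_{i ∈ S} x_i²`.
  generalize (Finset.univ : Finset (Fin (Module.finrank ℝ E))) = S
  induction S using Finset.induction_on with
  | empty => simpa using hA
  | insert i S hi ih =>
    have := ih.add hψ ((hA.mulInner hψ (stdOrthonormalBasis ℝ E i)).mulInner hψ
      (stdOrthonormalBasis ℝ E i))
    convert this using 2 with g
    rw [Finset.sum_insert hi]
    abel

/-- The weight `(1 + |x|²)^{-M}`. -/
def weight (M : ℕ) (x : E) : ℝ := (1 + ‖x‖ ^ 2) ^ (-(M : ℝ))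

theorem weight_mul_pow (M : ℕ) (x : E) : (1 + ‖x‖ ^ 2) ^ M * weight M x = 1 := by
  rw [weight, Real.rpow_neg (by positivity), Real.rpow_natCast]
  exact mul_inv_cancel₀ (by positivity)

/-- The bound for `g ↦ (1 + |x|²)^M g` is applied to `g = (1 + |x|²)^(-M) f`, which returns `f` on
the left and leaves the weight on the right. -/
theorem LocalBound.weighted (hψ : ContDiffOn ℝ ∞ ψ {0}ᶜ)
    (h : LocalBound ψ s (fun g : 𝓢(E, ℂ) => g)) (hm : IsCutoff m) (M : ℕ) :
    ∃ C : ℝ≥0, ∀ μ : ℝ, 1 ≤ μ → ∀ f : 𝓢(E, ℂ),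
      eLpNorm (maxOp (phaseSymbol ψ m μ) f) 2 (volume.restrict (Metric.ball 0 1))
        ≤ C * ENNReal.ofReal (μ ^ s) * eLpNorm (fun x => (weight M x : ℂ) * f x) 2 volume := by
  have hM : LocalBound ψ s (MaximalTransference.mulBracketSq (E := E))^[M] := by
    induction M with
    | zero => exact h
    | succ M ih =>
      rw [Function.iterate_succ']
      exact ih.mulBracketSq hψ
  obtain ⟨C, hC⟩ := hM m hm
  refine ⟨C, fun μ hμ f => ?_⟩
  have ht : (fun x : E => (weight M x : ℂ)).HasTemperateGrowth := by
    unfold weight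
    fun_prop
  have hw := hC μ hμ (SchwartzMap.smulLeftCLM ℂ (fun x : E => (weight M x : ℂ)) f)
  have hit (N : ℕ) (g : 𝓢(E, ℂ)) (x : E) :
      (MaximalTransference.mulBracketSq^[N] g) x = (((1 + ‖x‖ ^ 2) ^ N : ℝ) : ℂ) * g x := by
    induction N with
    | zero => simp
    | succ N ih =>
      rw [Function.iterate_succ_apply', mulBracketSq_apply, ih]
      push_cast
      ring
  have hf : MaximalTransference.mulBracketSq^[M]
      (SchwartzMap.smulLeftCLM ℂ (fun x : E => (weight M x : ℂ)) f) = f := by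
    ext x
    rw [hit, SchwartzMap.smulLeftCLM_apply_apply ht, smul_eq_mul, ← mul_assoc,
      ← Complex.ofReal_mul, weight_mul_pow]
    simp
  rw [hf] at hw
  refine hw.trans_eq ?_
  congr 2
  ext x
  rw [SchwartzMap.smulLeftCLM_apply_apply ht, smul_eq_mul]

theorem lintegral_weight_lt_top : ∫⁻ x : E, ‖(weight (Module.finrank ℝ E + 1) x : ℂ)‖ₑ ^ 2 < ⊤ := by
  -- With `d = finrank ℝ E`, the squared weight is `(1 + |x|²)^(-2(d+1))`, hence `r = 4(d+1) > d`.
  have hi := integrable_rpow_neg_one_add_norm_sq (E := E) (μ := volume)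
    (r := 4 * (Module.finrank ℝ E + 1 : ℝ)) (by
      have : (0 : ℝ) ≤ Module.finrank ℝ E := by positivity
      linarith)
  refine lt_of_eq_of_lt ?_ hi.2
  refine lintegral_congr fun x => ?_
  rw [← enorm_pow, ← ofReal_norm, ← ofReal_norm]
  congr 1
  rw [norm_pow, Complex.norm_real, ← norm_pow]
  congr 1
  rw [weight, ← Real.rpow_natCast, ← Real.rpow_mul (by positivity)]
  congr 1
  push_cast
  ring

/-- From the unit ball to the whole space, at frequencies comparable to `μ`. -/
theorem LocalBound.global (hψ : ContDiffOn ℝ ∞ ψ {0}ᶜ)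
    (h : LocalBound ψ s (fun g : 𝓢(E, ℂ) => g)) (hm : IsCutoff m) :
    ∃ C : ℝ≥0, ∀ μ : ℝ, 1 ≤ μ → ∀ f : 𝓢(E, ℂ),
      eLpNorm (maxOp (phaseSymbol ψ m μ) f) 2 volume
        ≤ C * ENNReal.ofReal (μ ^ s) * eLpNorm f 2 volume := by
  set M := Module.finrank ℝ E + 1
  obtain ⟨C, hC⟩ := h.weighted hψ hm M
  set V : ℝ≥0∞ := volume (Metric.ball (0 : E) 1) with hV
  have hV0 : V ≠ 0 := (Metric.measure_ball_pos volume _ one_pos).ne'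
  have hVt : V ≠ ⊤ := measure_ball_lt_top.ne
  set K : ℝ≥0∞ := ∫⁻ x : E, ‖(weight M x : ℂ)‖ₑ ^ 2 with hK
  have hKt : K ≠ ⊤ := lintegral_weight_lt_top.ne
  set D : ℝ≥0∞ := C * (K / V) ^ (1 / 2 : ℝ)
  have hD : D ≠ ⊤ := ENNReal.mul_ne_top ENNReal.coe_ne_top
    (ENNReal.rpow_ne_top_of_nonneg (by norm_num) (ENNReal.div_ne_top hKt hV0))
  refine ⟨D.toNNReal, fun μ hμ f => ?_⟩
  rw [ENNReal.coe_toNNReal hD]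
  set F := maxOp (phaseSymbol ψ m μ) f with hF
  have hFm : Measurable F := measurable_maxOp (fun t =>
    (isCutoff_phaseSymbol hψ hm (zero_lt_one.trans_le hμ) t).boundedSymbol) _
  -- The multipliers commute with translations, so the weighted bound holds on every unit ball;
  -- integrating in the centre `y` yields `V` on the left and `K` on the right.
  have hy (y : E) : ∫⁻ x in Metric.ball 0 1, F (x + y) ^ 2 ≤
      (C * ENNReal.ofReal (μ ^ s)) ^ 2 *
        ∫⁻ x, ‖(weight M x : ℂ)‖ₑ ^ 2 * ‖f (x + y)‖ₑ ^ 2 := by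
    have h1 := hC μ hμ (SchwartzMap.compSubConstCLM ℂ (-y) f)
    have h2 : maxOp (phaseSymbol ψ m μ) (SchwartzMap.compSubConstCLM ℂ (-y) f)
        = fun x => F (x + y) := by
      ext x
      simp only [maxOp, multiplier_translate, hF]
    rw [h2, ← ENNReal.pow_le_pow_left_iff two_ne_zero, mul_pow, eLpNorm_two_sq,
      eLpNorm_two_sq] at h1
    simpa [enorm_mul, mul_pow] using h1
  have hL : ∫⁻ y, ∫⁻ x in Metric.ball (0 : E) 1, F (x + y) ^ 2 = V * ∫⁻ x, F x ^ 2 := by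
    rw [lintegral_lintegral_swap (by fun_prop)]
    simp only [lintegral_add_left_eq_self (μ := (volume : Measure E)) (fun y => F y ^ 2)]
    rw [setLIntegral_const, mul_comm]
  have hR : ∫⁻ y, ∫⁻ x : E, ‖(weight M x : ℂ)‖ₑ ^ 2 * ‖f (x + y)‖ₑ ^ 2
      = K * ∫⁻ x, ‖f x‖ₑ ^ 2 := by
    have hw : Measurable (fun x : E => ‖(weight M x : ℂ)‖ₑ ^ 2) := by
      unfold weight
      fun_prop
    have hf : Measurable (fun x : E => ‖f x‖ₑ ^ 2) :=
      (f.continuous.measurable.enorm.pow_const 2)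
    rw [lintegral_lintegral_swap (((hw.comp measurable_snd).mul
      (hf.comp (measurable_snd.add measurable_fst))).aemeasurable)]
    simp only [lintegral_const_mul' _ _ (ENNReal.pow_ne_top enorm_ne_top),
      lintegral_add_left_eq_self (μ := (volume : Measure E)) (fun y => ‖f y‖ₑ ^ 2)]
    exact lintegral_mul_const _ hw
  have hmain : V * ∫⁻ x, F x ^ 2 ≤
      (C * ENNReal.ofReal (μ ^ s)) ^ 2 * (K * ∫⁻ x, ‖f x‖ₑ ^ 2) := by
    rw [← hL, ← hR, ← lintegral_const_mul' _ _ (by finiteness)]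
    exact lintegral_mono hy
  rw [← ENNReal.pow_le_pow_left_iff two_ne_zero, mul_pow, eLpNorm_two_sq, eLpNorm_two_sq]
  simp only [enorm_eq_self]
  have hDsq : D ^ 2 = C ^ 2 * (K / V) := by
    rw [mul_pow, ← ENNReal.rpow_natCast, ← ENNReal.rpow_natCast, ← ENNReal.rpow_mul]
    norm_num
  calc ∫⁻ x, F x ^ 2 = V⁻¹ * (V * ∫⁻ x, F x ^ 2) := by
        rw [← mul_assoc, ENNReal.inv_mul_cancel hV0 hVt, one_mul]
    _ ≤ V⁻¹ * ((C * ENNReal.ofReal (μ ^ s)) ^ 2 * (K * ∫⁻ x, ‖f x‖ₑ ^ 2)) := by gcongr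
    _ = _ := by
        rw [mul_pow, mul_pow, hDsq, div_eq_mul_inv]
        ring

/-- The estimate for unit time, at frequencies comparable to `N`, by rescaling. -/
theorem LocalBound.rescaled (hψ : ContDiffOn ℝ ∞ ψ {0}ᶜ) {a : ℝ} (ha : 1 ≤ a)
    (hhom : ∀ r : ℝ, 0 < r → ∀ ξ : E, ξ ≠ 0 → ψ (r • ξ) = r ^ a * ψ ξ)
    (h : LocalBound ψ s (fun g : 𝓢(E, ℂ) => g)) (hm : IsCutoff m) :
    ∃ C : ℝ≥0, ∀ N : ℝ, 1 ≤ N → ∀ f : 𝓢(E, ℂ),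
      eLpNorm (maxOp (fun t ξ => Complex.exp (Complex.I * ((t * ψ ξ : ℝ) : ℂ)) * m (N⁻¹ • ξ)) f)
        2 volume ≤ C * ENNReal.ofReal (N ^ (a * s)) * eLpNorm f 2 volume := by
  obtain ⟨C, hC⟩ := h.global hψ hm
  refine ⟨C, fun N hN f => ?_⟩
  have hN0 : 0 < N := zero_lt_one.trans_le hN
  have hl : 0 < N ^ (a - 1) := Real.rpow_pos_of_pos hN0 _
  -- At `μ = N^a`, replacing `ξ` by `N^(a-1) ξ` turns `ξ/μ` into `ξ/N`, and homogeneity turns the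
  -- phase into `t ψ(ξ)`.
  have h1 := hC (N ^ a) (Real.one_le_rpow hN (by linarith)) (dilate _ hl.ne' f)
  have hsymb (t : ℝ) (ξ : E) : phaseSymbol ψ m (N ^ a) t (N ^ (a - 1) • ξ) =
      Complex.exp (Complex.I * ((t * ψ ξ : ℝ) : ℂ)) * m (N⁻¹ • ξ) := by
    have e : (N ^ a)⁻¹ * N ^ (a - 1) = N⁻¹ := by
      rw [← Real.rpow_neg hN0.le, ← Real.rpow_add hN0, ← Real.rpow_neg_one]
      congr 1
      ring
    rw [phaseSymbol, smul_smul, e]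
    rcases eq_or_ne ξ 0 with rfl | hξ
    · simp [hm.eventually_eq_zero.self_of_nhds]
    · rw [hhom _ (by positivity) ξ hξ, mul_assoc t, ← mul_assoc (N ^ a), Real.inv_rpow hN0.le,
        mul_inv_cancel₀ (by positivity), one_mul]
  have h2 : maxOp (phaseSymbol ψ m (N ^ a)) (dilate _ hl.ne' f) = fun x =>
      maxOp (fun t ξ => Complex.exp (Complex.I * ((t * ψ ξ : ℝ) : ℂ)) * m (N⁻¹ • ξ)) f
        (N ^ (a - 1) • x) := by
    ext x
    refine iSup_congr fun t => iSup_congr fun _ => ?_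
    rw [multiplier_dilate _ hl]
    simp only [hsymb]
  have h3 : (⇑(dilate _ hl.ne' f) : E → ℂ) = fun x => f (N ^ (a - 1) • x) := by
    ext x; exact dilate_apply _ _ _
  -- Both sides acquire the same Jacobian factor, which cancels.
  rw [h2, h3, eLpNorm_two_comp_smul _ hl, eLpNorm_two_comp_smul _ hl, mul_left_comm,
    ENNReal.mul_le_mul_iff_right (by simpa using Real.rpow_pos_of_pos hl _)
      ENNReal.ofReal_ne_top, ← Real.rpow_mul hN0.le] at h1
  exact h1

end Globalization

/-! ### Dyadic decomposition and summation. -/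

section Summation

variable {E : Type*} [NormedAddCommGroup E] [InnerProductSpace ℝ E] [FiniteDimensional ℝ E]
  [MeasurableSpace E] [BorelSpace E] {ψ : E → ℝ} {m : E → ℂ} {s : ℝ}

theorem multiplier_sum {ι : Type*} (S : Finset ι) {b : ι → E → ℂ} (hb : ∀ k, BoundedSymbol (b k))
    (g : 𝓢(E, ℂ)) (x : E) :
    multiplier (fun ξ => ∑ k ∈ S, b k ξ) g x = ∑ k ∈ S, multiplier (b k) g x := by
  simp only [multiplier_apply]
  rw [← integral_finsetSum _ fun k _ => integrable_exp_mul ((hb k).integrable _) x]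
  congr 1
  ext ξ
  rw [Finset.sum_mul, Finset.mul_sum]

theorem enorm_multiplier_le_tsum {b : ℕ → E → ℂ} {B : E → ℂ} {C : ℝ}
    (hb : ∀ k, BoundedSymbol (b k))
    (hC : ∀ n ξ, ‖∑ k ∈ Finset.range n, b k ξ‖ ≤ C)
    (hlim : ∀ ξ, Tendsto (fun n => ∑ k ∈ Finset.range n, b k ξ) atTop (𝓝 (B ξ)))
    (g : 𝓢(E, ℂ)) (x : E) :
    ‖multiplier B g x‖ₑ ≤ ∑' k, ‖multiplier (b k) g x‖ₑ := by
  have ht : Tendsto (fun n => multiplier (fun ξ => ∑ k ∈ Finset.range n, b k ξ) g x) atTop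
      (𝓝 (multiplier B g x)) := by
    simp only [multiplier_apply]
    refine tendsto_integral_of_dominated_convergence (fun ξ => C * ‖(𝓕 g : 𝓢(E, ℂ)) ξ‖)
      (fun n => ?_) ((SchwartzMap.integrable _).norm.const_mul C) (fun n => ae_of_all _ fun ξ => ?_)
      (ae_of_all _ fun ξ => ?_)
    · have : Measurable (fun ξ => ∑ k ∈ Finset.range n, b k ξ) :=
        Finset.measurable_fun_sum _ fun k _ => (hb k).1
      exact (Continuous.aestronglyMeasurable (by fun_prop)).mul
        (this.aestronglyMeasurable.mul (SchwartzMap.continuous _).aestronglyMeasurable)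
    · rw [norm_mul, norm_mul, Complex.norm_exp_ofReal_mul_I, one_mul]
      gcongr
      exact hC n ξ
    · exact ((hlim ξ).mul_const _).const_mul _
  refine le_of_tendsto' ht.enorm fun n => ?_
  rw [multiplier_sum _ hb]
  exact (enorm_sum_le _ _).trans (ENNReal.sum_le_tsum _)

/-- The Japanese bracket of `2πξ`. -/
def bracket (ξ : E) : ℝ := √(1 + ‖(2 * Real.pi) • ξ‖ ^ 2)

theorem one_le_bracket (ξ : E) : 1 ≤ bracket ξ := by
  rw [bracket, Real.one_le_sqrt]
  nlinarith [norm_nonneg ((2 * Real.pi) • ξ)]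

theorem norm_le_bracket (ξ : E) : 2 * Real.pi * ‖ξ‖ ≤ bracket ξ := by
  apply Real.le_sqrt_of_sq_le
  rw [norm_smul, Real.norm_of_nonneg (by positivity)]
  linarith

variable (E) in
/-- A smooth function equal to `1` on the unit ball and supported in the ball of radius `2`. -/
def bump : ContDiffBump (0 : E) := ⟨1, 2, one_pos, one_lt_two⟩

theorem bump_eq_one {ξ : E} (h : ‖ξ‖ ≤ 1) : bump E ξ = 1 :=
  (bump E).one_of_mem_closedBall (mem_closedBall_zero_iff.2 h)

theorem bump_eq_zero {ξ : E} (h : 2 ≤ ‖ξ‖) : bump E ξ = 0 :=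
  (bump E).zero_of_le_dist (by rw [dist_zero_right]; exact h)

/-- The difference of the dilates of `bump` with factors `c` and `d`. -/
def bumpDiff (c d : ℝ) (ξ : E) : ℂ := (bump E (c • ξ) : ℂ) - (bump E (d • ξ) : ℂ)

theorem isCutoff_bumpDiff {c d : ℝ} (hc : c ≠ 0) (hd : d ≠ 0) :
    IsCutoff (bumpDiff c d : E → ℂ) where
  contDiff := (Complex.ofRealCLM.contDiff.comp ((bump E).contDiff.comp (contDiff_const_smul c))).sub
    (Complex.ofRealCLM.contDiff.comp ((bump E).contDiff.comp (contDiff_const_smul d)))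
  hasCompactSupport := by
    have h (c : ℝ) (hc : c ≠ 0) : HasCompactSupport (fun ξ : E => (bump E (c • ξ) : ℂ)) :=
      ((bump E).hasCompactSupport.comp_smul hc).comp_left (g := Complex.ofReal) (by simp)
    exact (h c hc).sub (h d hd)
  eventually_eq_zero := by
    have h (c : ℝ) : ∀ᶠ ξ : E in 𝓝 0, ‖c • ξ‖ < 1 := by
      have : Tendsto (fun ξ : E => ‖c • ξ‖) (𝓝 0) (𝓝 0) := by
        have h0 : Continuous (fun ξ : E => ‖c • ξ‖) := by fun_prop
        simpa using h0.tendsto 0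
      exact this.eventually (gt_mem_nhds one_pos)
    filter_upwards [h c, h d] with ξ h1 h2
    rw [bumpDiff, bump_eq_one h1.le, bump_eq_one h2.le, sub_self]

theorem norm_bumpDiff_le (c d : ℝ) (ξ : E) : ‖bumpDiff c d ξ‖ ≤ 1 := by
  rw [bumpDiff, ← Complex.ofReal_sub, Complex.norm_real, Real.norm_eq_abs, abs_le]
  have h1 := (bump E).nonneg (x := c • ξ)
  have h2 := (bump E).nonneg (x := d • ξ)
  have h3 := (bump E).le_one (x := c • ξ)
  have h4 := (bump E).le_one (x := d • ξ)
  constructor <;> linarith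

/-- The wider cutoff is `1` on the support of the narrow one, so `f` may be localised to a dyadic
block before the block estimate is applied. -/
theorem bumpDiff_mul_bumpDiff (ξ : E) :
    bumpDiff 1 2 ξ * bumpDiff (1 / 2) 4 ξ = bumpDiff 1 2 ξ := by
  have n2 : ‖(2 : ℝ) • ξ‖ = 2 * ‖ξ‖ := by rw [norm_smul]; norm_num
  have n4 : ‖(4 : ℝ) • ξ‖ = 4 * ‖ξ‖ := by rw [norm_smul]; norm_num
  have nh : ‖(1 / 2 : ℝ) • ξ‖ = 1 / 2 * ‖ξ‖ := by rw [norm_smul]; norm_num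
  unfold bumpDiff
  rw [one_smul]
  by_cases h : ‖ξ‖ ≤ 1 / 2
  · rw [bump_eq_one (ξ := ξ) (by linarith), bump_eq_one (ξ := (2 : ℝ) • ξ) (by linarith)]
    simp
  · by_cases h' : 2 ≤ ‖ξ‖
    · rw [bump_eq_zero h', bump_eq_zero (ξ := (2 : ℝ) • ξ) (by linarith)]
      simp
    · rw [bump_eq_one (ξ := (1 / 2 : ℝ) • ξ) (by linarith),
        bump_eq_zero (ξ := (4 : ℝ) • ξ) (by linarith)]
      simp

theorem sum_bumpDiff (n : ℕ) (ξ : E) :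
    ∑ j ∈ Finset.range n, bumpDiff 1 2 (((2 : ℝ) ^ (j + 1))⁻¹ • ξ) =
      bumpDiff ((2 : ℝ) ^ n)⁻¹ 1 ξ := by
  have h := Finset.sum_range_sub (fun j : ℕ => (bump E (((2 : ℝ) ^ j)⁻¹ • ξ) : ℂ)) n
  rw [pow_zero, inv_one] at h
  refine Eq.trans (Finset.sum_congr rfl fun j _ => ?_) h
  rw [bumpDiff, one_smul, smul_smul]
  congr 5
  field_simp
  ring

/-- On the support `|ξ| > N/4`, so `bracket ξ ≥ 2π|ξ| ≥ N`; this converts the `L²` norm of a block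
into `N^(-s)` times the Sobolev norm. -/
theorem norm_bumpDiff_le_bracket {N : ℝ} (hN : 1 ≤ N) (hs : 0 < s) (ξ : E) :
    ‖bumpDiff (1 / 2) 4 (N⁻¹ • ξ)‖ ≤ N ^ (-s) * bracket ξ ^ s := by
  have hN0 : 0 < N := by linarith
  by_cases h : ‖N⁻¹ • ξ‖ ≤ 1 / 4
  · have e1 : ‖(1 / 2 : ℝ) • N⁻¹ • ξ‖ ≤ 1 := by rw [norm_smul]; norm_num; linarith
    have e2 : ‖(4 : ℝ) • N⁻¹ • ξ‖ ≤ 1 := by rw [norm_smul]; norm_num; linarith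
    rw [bumpDiff, bump_eq_one e1, bump_eq_one e2, sub_self, norm_zero]
    have := one_le_bracket ξ
    positivity
  · refine (norm_bumpDiff_le _ _ _).trans ?_
    rw [Real.rpow_neg hN0.le, ← div_eq_inv_mul, one_le_div (by positivity)]
    refine Real.rpow_le_rpow hN0.le ?_ hs.le
    refine le_trans ?_ (norm_le_bracket ξ)
    rw [norm_smul, norm_inv, Real.norm_of_nonneg hN0.le, not_le, ← div_eq_inv_mul,
      lt_div_iff₀ hN0] at h
    nlinarith [Real.pi_gt_three, norm_nonneg ξ]

theorem boundedSymbol_exp (hψ : Measurable ψ) (t : ℝ) :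
    BoundedSymbol (fun ξ => Complex.exp (Complex.I * ((t * ψ ξ : ℝ) : ℂ))) := by
  refine ⟨by fun_prop, 1, fun ξ => ?_⟩
  dsimp only
  rw [mul_comm, Complex.norm_exp_ofReal_mul_I]

theorem exists_bound_of_homogeneous {a : ℝ} (ha : 1 ≤ a) (hψ : ContDiffOn ℝ ∞ ψ {0}ᶜ)
    (hhom : ∀ r : ℝ, 0 < r → ∀ ξ : E, ξ ≠ 0 → ψ (r • ξ) = r ^ a * ψ ξ) (R : ℝ) :
    ∃ K : ℝ, 0 ≤ K ∧ ∀ ξ, ‖ξ‖ ≤ R → |ψ ξ| ≤ K := by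
  obtain ⟨B, hB⟩ := (isCompact_sphere (0 : E) 1).exists_bound_of_continuousOn
    (hψ.continuousOn.mono fun ξ hξ h0 => by simp [mem_singleton_iff.1 h0] at hξ)
  -- Homogeneity says nothing about the value at the origin, so it enters the bound separately.
  refine ⟨max |ψ 0| (R ^ a * max B 0), le_max_of_le_left (abs_nonneg _), fun ξ hξ => ?_⟩
  rcases eq_or_ne ξ 0 with rfl | h0
  · exact le_max_left _ _
  · have hn : 0 < ‖ξ‖ := norm_pos_iff.2 h0
    have hu : ‖ξ‖⁻¹ • ξ ≠ 0 := smul_ne_zero (inv_ne_zero hn.ne') h0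
    have h1 := hhom ‖ξ‖ hn _ hu
    rw [smul_inv_smul₀ hn.ne'] at h1
    have h2 : |ψ (‖ξ‖⁻¹ • ξ)| ≤ B :=
      hB _ (by simp [norm_smul, hn.ne'])
    refine le_max_of_le_right ?_
    rw [h1, abs_mul, abs_of_nonneg (by positivity)]
    have h3 : ‖ξ‖ ^ a ≤ R ^ a := Real.rpow_le_rpow hn.le hξ (by linarith)
    exact mul_le_mul h3 (h2.trans (le_max_left _ _)) (abs_nonneg _)
      (h3.trans' (by positivity))

/-- The estimate for one dyadic block, with a gain. -/
theorem exists_dyadic_bound (hψ : ContDiffOn ℝ ∞ ψ {0}ᶜ) {a s' : ℝ} (ha : 1 ≤ a) (hs : 0 < s)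
    (hhom : ∀ r : ℝ, 0 < r → ∀ ξ : E, ξ ≠ 0 → ψ (r • ξ) = r ^ a * ψ ξ)
    (h : LocalBound ψ s' (fun g : 𝓢(E, ℂ) => g)) :
    ∃ C : ℝ≥0, ∀ N : ℝ, 1 ≤ N → ∀ f : 𝓢(E, ℂ),
      eLpNorm (maxOp (fun t ξ => Complex.exp (Complex.I * ((t * ψ ξ : ℝ) : ℂ)) *
        bumpDiff 1 2 (N⁻¹ • ξ)) f) 2 volume ≤ C * ENNReal.ofReal (N ^ (a * s' - s)) *
          eLpNorm (fun ξ => ((bracket ξ ^ s : ℝ) : ℂ) * (𝓕 f : 𝓢(E, ℂ)) ξ) 2 volume := by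
  obtain ⟨C, hC⟩ := h.rescaled hψ ha hhom (isCutoff_bumpDiff one_ne_zero two_ne_zero)
  refine ⟨C, fun N hN f => ?_⟩
  have hN0 : 0 < N := by linarith
  have hcut : IsCutoff (fun ξ : E => bumpDiff (1 / 2) 4 (N⁻¹ • ξ)) :=
    (isCutoff_bumpDiff (by norm_num) (by norm_num)).comp_smul (inv_ne_zero hN0.ne')
  have h1 := hC N hN (SchwartzMap.fourierMultiplierCLM ℂ
    (fun ξ : E => bumpDiff (1 / 2) 4 (N⁻¹ • ξ)) f)
  have h2 : maxOp (fun t ξ => Complex.exp (Complex.I * ((t * ψ ξ : ℝ) : ℂ)) *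
      bumpDiff 1 2 (N⁻¹ • ξ)) (SchwartzMap.fourierMultiplierCLM ℂ
        (fun ξ : E => bumpDiff (1 / 2) 4 (N⁻¹ • ξ)) f) =
      maxOp (fun t ξ => Complex.exp (Complex.I * ((t * ψ ξ : ℝ) : ℂ)) *
        bumpDiff 1 2 (N⁻¹ • ξ)) f := by
    ext x
    simp only [maxOp, multiplier_fourierMultiplierCLM _ hcut.hasTemperateGrowth, mul_assoc,
      bumpDiff_mul_bumpDiff]
  rw [h2] at h1
  refine h1.trans ?_
  have h3 : eLpNorm (SchwartzMap.fourierMultiplierCLM ℂ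
        (fun ξ : E => bumpDiff (1 / 2) 4 (N⁻¹ • ξ)) f) 2 volume ≤
      ENNReal.ofReal (N ^ (-s)) *
        eLpNorm (fun ξ => ((bracket ξ ^ s : ℝ) : ℂ) * (𝓕 f : 𝓢(E, ℂ)) ξ) 2 volume := by
    rw [← eLpNorm_fourier]
    refine eLpNorm_le_mul_eLpNorm_of_ae_le_mul (ae_of_all _ fun ξ => ?_) 2
    rw [SchwartzMap.fourierMultiplierCLM_apply, fourier_fourierInv_eq,
      SchwartzMap.smulLeftCLM_apply_apply hcut.hasTemperateGrowth, smul_eq_mul, norm_mul, norm_mul,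
      Complex.norm_real, Real.norm_of_nonneg (r := bracket ξ ^ s) (Real.rpow_nonneg
        (zero_le_one.trans (one_le_bracket ξ)) _), ← mul_assoc]
    gcongr
    exact norm_bumpDiff_le_bracket hN hs ξ
  refine (mul_le_mul' le_rfl h3).trans_eq ?_
  rw [sub_eq_add_neg, Real.rpow_add hN0, ENNReal.ofReal_mul (by positivity)]
  ring

theorem eLpNorm_multiplier_le {b : E → ℂ} (hb : BoundedSymbol b) {C : ℝ} (hC : ∀ ξ, ‖b ξ‖ ≤ C)
    (hs : 0 < s) (f : 𝓢(E, ℂ)) :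
    eLpNorm (multiplier b f) 2 volume ≤ ENNReal.ofReal C *
      eLpNorm (fun ξ => ((bracket ξ ^ s : ℝ) : ℂ) * (𝓕 f : 𝓢(E, ℂ)) ξ) 2 volume := by
  rw [hb.eLpNorm_multiplier]
  refine eLpNorm_le_mul_eLpNorm_of_ae_le_mul (ae_of_all _ fun ξ => ?_) 2
  have h1 : 1 ≤ bracket ξ ^ s := Real.one_le_rpow (one_le_bracket ξ) hs.le
  rw [norm_mul, norm_mul, Complex.norm_real, Real.norm_of_nonneg (by linarith)]
  refine mul_le_mul (hC ξ) ?_ (norm_nonneg _) ((norm_nonneg _).trans (hC ξ))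
  exact le_mul_of_one_le_left (norm_nonneg _) h1

theorem exists_global_bound (hψ : ContDiffOn ℝ ∞ ψ {0}ᶜ) {a s' : ℝ} (ha : 1 ≤ a) (hs : 0 < s)
    (hhom : ∀ r : ℝ, 0 < r → ∀ ξ : E, ξ ≠ 0 → ψ (r • ξ) = r ^ a * ψ ξ)
    (h : LocalBound ψ s' (fun g : 𝓢(E, ℂ) => g)) (hss : a * s' < s) :
    ∃ C : ℝ≥0, ∀ f : 𝓢(E, ℂ),
      eLpNorm (maxOp (fun t ξ => Complex.exp (Complex.I * ((t * ψ ξ : ℝ) : ℂ))) f) 2 volume ≤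
        C * eLpNorm (fun ξ => ((bracket ξ ^ s : ℝ) : ℂ) * (𝓕 f : 𝓢(E, ℂ)) ξ) 2 volume := by
  obtain ⟨C, hC⟩ := exists_dyadic_bound hψ ha hs hhom h
  obtain ⟨K, hK0, hK⟩ := exists_bound_of_homogeneous ha hψ hhom 2
  have hψm : Measurable ψ := measurable_of_continuousOn_compl_singleton 0 hψ.continuousOn
  set q : ℝ := 2 ^ (a * s' - s) with hq
  have hq0 : 0 < q := by positivity
  have hq1 : q < 1 := Real.rpow_lt_one_of_one_lt_of_neg one_lt_two (by linarith)
  set A : ℝ≥0∞ := ∑' k : ℕ, ENNReal.ofReal (K ^ k / k.factorial) with hA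
  have hAt : A ≠ ⊤ := (Real.summable_pow_div_factorial K).tsum_ofReal_ne_top
  set B : ℝ≥0∞ := ∑' j : ℕ, C * ENNReal.ofReal (q ^ (j + 1)) with hB
  have hBt : B ≠ ⊤ := by
    rw [hB, ENNReal.tsum_mul_left]
    exact ENNReal.mul_ne_top ENNReal.coe_ne_top
      ((summable_nat_add_iff 1).2 (summable_geometric_of_lt_one hq0.le hq1)).tsum_ofReal_ne_top
  refine ⟨(A + B).toNNReal, fun f => ?_⟩
  rw [ENNReal.coe_toNNReal (ENNReal.add_ne_top.2 ⟨hAt, hBt⟩)]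
  set S := eLpNorm (fun ξ => ((bracket ξ ^ s : ℝ) : ℂ) * (𝓕 f : 𝓢(E, ℂ)) ξ) 2 volume
  -- The Taylor terms of `e^{itψ}` on low frequencies, without the factor `(it)^k`: they do not
  -- depend on `t`, and `|(it)^k| ≤ 1`, so the supremum over `t` costs nothing.
  let low (k : ℕ) (ξ : E) : ℂ := ((ψ ξ ^ k / k.factorial * bump E ξ : ℝ) : ℂ)
  -- The index `j + 1` makes the blocks telescope to `1 - bump`.
  let high (j : ℕ) (t : ℝ) (ξ : E) : ℂ := Complex.exp (Complex.I * ((t * ψ ξ : ℝ) : ℂ)) *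
    bumpDiff 1 2 (((2 : ℝ) ^ (j + 1))⁻¹ • ξ)
  have hbump : Measurable (bump E : E → ℝ) := (bump E).continuous.measurable
  have hlow_le (k : ℕ) (ξ : E) : ‖low k ξ‖ ≤ K ^ k / k.factorial := by
    simp only [low, Complex.norm_real, Real.norm_eq_abs, abs_mul, abs_div, abs_pow, Nat.abs_cast,
      abs_of_nonneg (bump E).nonneg]
    by_cases hξ : 2 ≤ ‖ξ‖
    · rw [bump_eq_zero hξ, mul_zero]
      positivity
    · refine (mul_le_of_le_one_right (by positivity) (bump E).le_one).trans ?_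
      gcongr
      exact hK ξ (by linarith)
  have hlow (k : ℕ) : BoundedSymbol (low k) :=
    ⟨by fun_prop, _, hlow_le k⟩
  have hhigh (j : ℕ) (t : ℝ) : BoundedSymbol (high j t) :=
    (boundedSymbol_exp hψm t).mul
      ((isCutoff_bumpDiff one_ne_zero two_ne_zero).boundedSymbol.comp_smul _)
  have hpt (x : E) : maxOp (fun t ξ => Complex.exp (Complex.I * ((t * ψ ξ : ℝ) : ℂ))) f x ≤
      ∑' k, ‖multiplier (low k) f x‖ₑ + ∑' j, maxOp (high j) f x := by
    refine iSup₂_le fun t ht => ?_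
    have hb : BoundedSymbol (fun ξ : E => (bump E ξ : ℂ)) :=
      ⟨by fun_prop, 1, fun ξ => by
        rw [Complex.norm_real, Real.norm_of_nonneg (bump E).nonneg]; exact (bump E).le_one⟩
    have hb' : BoundedSymbol (fun ξ : E => 1 + (-1) * (bump E ξ : ℂ)) :=
      BoundedSymbol.add ⟨measurable_const, 1, by simp⟩ (hb.const_mul _)
    have he := boundedSymbol_exp hψm t
    have hsplit : (fun ξ => Complex.exp (Complex.I * ((t * ψ ξ : ℝ) : ℂ))) =
        fun ξ => Complex.exp (Complex.I * ((t * ψ ξ : ℝ) : ℂ)) * (bump E ξ : ℂ) +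
          Complex.exp (Complex.I * ((t * ψ ξ : ℝ) : ℂ)) * (1 + (-1) * (bump E ξ : ℂ)) := by
      ext ξ; ring
    dsimp only
    rw [hsplit, multiplier_add_symbol (he.mul hb) (he.mul hb')]
    refine (enorm_add_le _ _).trans (add_le_add ?_ ?_)
    · have hIt (k : ℕ) : ‖(Complex.I * t) ^ k‖ ≤ 1 := by
        rw [norm_pow]
        refine pow_le_one₀ (norm_nonneg _) ?_
        simpa [abs_of_pos ht.1] using ht.2.le
      have h1 := enorm_multiplier_le_tsum (b := fun k ξ => (Complex.I * t) ^ k * low k ξ)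
        (B := fun ξ => Complex.exp (Complex.I * ((t * ψ ξ : ℝ) : ℂ)) * (bump E ξ : ℂ))
        (C := Real.exp K) (fun k => (hlow k).const_mul _) ?_ ?_ f x
      · refine h1.trans (ENNReal.tsum_le_tsum fun k => ?_)
        rw [multiplier_const_mul, enorm_mul]
        refine (mul_le_mul' ?_ le_rfl).trans_eq (one_mul _)
        rw [← ofReal_norm, ENNReal.ofReal_le_one]
        exact hIt k
      · intro n ξ
        refine (norm_sum_le _ _).trans ((Finset.sum_le_sum fun k _ => ?_).trans
          (Real.sum_le_exp_of_nonneg hK0 n))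
        rw [norm_mul]
        exact (mul_le_of_le_one_left (norm_nonneg _) (hIt k)).trans (hlow_le k ξ)
      · intro ξ
        have h2 := ((NormedSpace.expSeries_div_hasSum_exp
          (Complex.I * ((t * ψ ξ : ℝ) : ℂ))).mul_right (bump E ξ : ℂ)).tendsto_sum_nat
        rw [← Complex.exp_eq_exp_ℂ] at h2
        refine h2.congr fun n => Finset.sum_congr rfl fun k _ => ?_
        simp only [low]
        push_cast
        ring
    · have h1 := enorm_multiplier_le_tsum (b := fun j => high j t)
        (B := fun ξ => Complex.exp (Complex.I * ((t * ψ ξ : ℝ) : ℂ)) *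
          (1 + (-1) * (bump E ξ : ℂ)))
        (C := 1) (fun j => hhigh j t) ?_ ?_ f x
      · exact h1.trans (ENNReal.tsum_le_tsum fun j => le_maxOp (high j) f x ht)
      · intro n ξ
        simp only [high]
        rw [← Finset.mul_sum, sum_bumpDiff, norm_mul, mul_comm Complex.I,
          Complex.norm_exp_ofReal_mul_I, one_mul]
        exact norm_bumpDiff_le _ _ _
      · intro ξ
        simp only [high, ← Finset.mul_sum, sum_bumpDiff]
        refine Tendsto.const_mul _ (tendsto_const_nhds.congr' ?_)
        filter_upwards [(tendsto_pow_atTop_atTop_of_one_lt (one_lt_two (α := ℝ))).eventually_ge_atTop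
          ‖ξ‖] with n hn
        rw [bumpDiff, one_smul, bump_eq_one (ξ := ((2 : ℝ) ^ n)⁻¹ • ξ)]
        · push_cast
          ring
        · rw [norm_smul, norm_inv, norm_pow, Real.norm_ofNat]
          exact inv_mul_le_one_of_le₀ hn (by positivity)
  have hmlow (k : ℕ) : Measurable (fun x => ‖multiplier (low k) f x‖ₑ) :=
    ((hlow k).continuous_multiplier f).measurable.enorm
  have hmhigh (j : ℕ) : Measurable (maxOp (high j) f) := measurable_maxOp (hhigh j) f
  calc eLpNorm (maxOp (fun t ξ => Complex.exp (Complex.I * ((t * ψ ξ : ℝ) : ℂ))) f) 2 volume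
      ≤ eLpNorm ((fun x => ∑' k, ‖multiplier (low k) f x‖ₑ) + fun x => ∑' j, maxOp (high j) f x)
          2 volume := eLpNorm_mono_enorm fun x => by simpa using hpt x
    _ ≤ _ := eLpNorm_add_le (Measurable.tsum hmlow).aestronglyMeasurable
          (Measurable.tsum hmhigh).aestronglyMeasurable (by norm_num)
    _ ≤ ∑' k, eLpNorm (fun x => ‖multiplier (low k) f x‖ₑ) 2 volume +
          ∑' j, eLpNorm (maxOp (high j) f) 2 volume :=
        add_le_add (eLpNorm_two_tsum_le hmlow) (eLpNorm_two_tsum_le hmhigh)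
    _ ≤ A * S + B * S := by
        rw [hA, hB, ← ENNReal.tsum_mul_right, ← ENNReal.tsum_mul_right]
        refine add_le_add (ENNReal.tsum_le_tsum fun k => ?_) (ENNReal.tsum_le_tsum fun j => ?_)
        · rw [eLpNorm_enorm]
          exact eLpNorm_multiplier_le (hlow k) (hlow_le k) hs f
        · refine (hC _ (one_le_pow₀ one_le_two) f).trans_eq ?_
          congr 3
          rw [hq, ← Real.rpow_natCast, ← Real.rpow_natCast, ← Real.rpow_mul (by norm_num),
            ← Real.rpow_mul (by norm_num), mul_comm]
    _ = _ := (add_mul _ _ _).symm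

end Summation

/-! ### Passage between the two Fourier normalisations, and the local bound from the hypothesis. -/

section Transfer

variable {n : ℕ}

theorem hat_eq_fourier (f : 𝓢(EuclideanSpace ℝ (Fin n), ℂ)) (ξ : EuclideanSpace ℝ (Fin n)) :
    hat f ((2 * Real.pi) • ξ) = (𝓕 f : 𝓢(EuclideanSpace ℝ (Fin n), ℂ)) ξ := by
  rw [SchwartzMap.fourier_coe, Real.fourier_eq', hat]
  congr 1
  ext x
  rw [real_inner_smul_right, smul_eq_mul]
  congr 2
  push_cast
  ring

theorem T_eq_multiplier (φ : EuclideanSpace ℝ (Fin n) → ℝ) (t : ℝ)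
    (f : 𝓢(EuclideanSpace ℝ (Fin n), ℂ)) (x : EuclideanSpace ℝ (Fin n)) :
    T φ t f x = (((2 * Real.pi) ^ n : ℝ) : ℂ) * multiplier (fun ξ =>
      Complex.exp (Complex.I * ((t * φ ((2 * Real.pi) • ξ) : ℝ) : ℂ))) f x := by
  have h := Measure.integral_comp_smul (volume : Measure (EuclideanSpace ℝ (Fin n)))
    (fun ξ => Complex.exp (Complex.I * ((⟪x, ξ⟫ : ℝ) : ℂ) + Complex.I * ((t * φ ξ : ℝ) : ℂ)) *
      hat f ξ) (2 * Real.pi)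
  rw [abs_of_pos (by positivity), finrank_euclideanSpace_fin, eq_inv_smul_iff₀ (by positivity)] at h
  rw [T, ← h, multiplier_apply, Complex.real_smul]
  congr 2
  ext ξ
  rw [hat_eq_fourier, Complex.exp_add, real_inner_smul_right, real_inner_comm, mul_assoc]
  congr 2
  push_cast
  ring

theorem sobolevNorm_eq (s : ℝ) (f : 𝓢(EuclideanSpace ℝ (Fin n), ℂ)) :
    eLpNorm (fun ξ => ((bracket ξ ^ s : ℝ) : ℂ) * (𝓕 f : 𝓢(EuclideanSpace ℝ (Fin n), ℂ)) ξ) 2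
      volume = ENNReal.ofReal ((2 * Real.pi) ^ (-(n : ℝ) / 2)) * sobolevNorm s f := by
  have h := eLpNorm_two_comp_smul (fun ξ : EuclideanSpace ℝ (Fin n) =>
    ((√(1 + ‖ξ‖ ^ 2) ^ s : ℝ) : ℂ) * hat f ξ) (c := 2 * Real.pi) (by positivity)
  rw [finrank_euclideanSpace_fin] at h
  rw [sobolevNorm, ← h]
  simp only [hat_eq_fourier, bracket]

theorem maximalFn_eq (φ : EuclideanSpace ℝ (Fin n) → ℝ)
    (f : 𝓢(EuclideanSpace ℝ (Fin n), ℂ)) :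
    maximalFn φ f = fun x => ENNReal.ofReal ((2 * Real.pi) ^ n) * maxOp (fun t ξ =>
      Complex.exp (Complex.I * ((t * φ ((2 * Real.pi) • ξ) : ℝ) : ℂ))) f x := by
  ext x
  simp only [maximalFn, maxOp, T_eq_multiplier, enorm_mul, ENNReal.mul_iSup]
  refine iSup_congr fun t => iSup_congr fun _ => ?_
  congr 1
  rw [← ofReal_norm, Complex.norm_real, Real.norm_of_nonneg (by positivity)]

theorem bracket_le_mul {E : Type*} [NormedAddCommGroup E] [InnerProductSpace ℝ E] {μ : ℝ}
    (hμ : 1 ≤ μ) (ξ : E) : bracket ξ ≤ μ * bracket (μ⁻¹ • ξ) := by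
  have hμ0 : 0 < μ := by linarith
  refine Real.sqrt_le_iff.2 ⟨mul_nonneg hμ0.le (Real.sqrt_nonneg _), ?_⟩
  rw [mul_pow, bracket, Real.sq_sqrt (by positivity), smul_comm, norm_smul μ⁻¹, norm_inv,
    Real.norm_of_nonneg hμ0.le, mul_add, mul_pow, inv_pow, ← mul_assoc,
    mul_inv_cancel₀ (by positivity), one_mul]
  nlinarith

/-- Since `bracket ξ ≤ μ · bracket (ξ/μ)`, it suffices that `bracket ^ s · m` is continuous with
compact support, hence bounded. -/
theorem IsCutoff.exists_bracket_bound {E : Type*} [NormedAddCommGroup E] [InnerProductSpace ℝ E]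
    [FiniteDimensional ℝ E] {m : E → ℂ} (hm : IsCutoff m) {s : ℝ} (hs : 0 < s) :
    ∃ K : ℝ≥0, ∀ μ : ℝ, 1 ≤ μ → ∀ ξ, bracket ξ ^ s * ‖m (μ⁻¹ • ξ)‖ ≤ K * μ ^ s := by
  have hc : Continuous (fun ξ : E => bracket ξ ^ s • m ξ) := by
    refine Continuous.smul (Continuous.rpow_const ?_ fun _ => Or.inr hs.le) hm.contDiff.continuous
    unfold bracket
    fun_prop
  obtain ⟨K, hK⟩ := (hm.hasCompactSupport.smul_left (f := fun ξ : E => bracket ξ ^ s)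
    ).exists_bound_of_continuous hc
  refine ⟨K.toNNReal, fun μ hμ ξ => ?_⟩
  have hμ0 : 0 < μ := by linarith
  have h0 : 0 ≤ bracket (μ⁻¹ • ξ) := Real.sqrt_nonneg _
  have h1 := hK (μ⁻¹ • ξ)
  simp only [Pi.smul_apply', norm_smul, Real.norm_of_nonneg (Real.rpow_nonneg h0 s)] at h1
  calc bracket ξ ^ s * ‖m (μ⁻¹ • ξ)‖
      ≤ (μ * bracket (μ⁻¹ • ξ)) ^ s * ‖m (μ⁻¹ • ξ)‖ := by
        gcongr
        · exact Real.sqrt_nonneg _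
        · exact bracket_le_mul hμ ξ
    _ = bracket (μ⁻¹ • ξ) ^ s * ‖m (μ⁻¹ • ξ)‖ * μ ^ s := by
        rw [Real.mul_rpow hμ0.le h0]
        ring
    _ ≤ K.toNNReal * μ ^ s := by
        gcongr
        exact h1.trans (Real.le_coe_toNNReal K)

/-- The hypothesis is applied to `g` localised at frequency `μ`, whose `H^s` norm is at most a
constant times `μ^s ‖g‖₂`. -/
theorem MaximalEstimate.localBound {φ : EuclideanSpace ℝ (Fin n) → ℝ} {a s : ℝ} (ha : 1 ≤ a)
    (hs : 0 < s)
    (hhom : ∀ r : ℝ, 0 < r → ∀ ξ : EuclideanSpace ℝ (Fin n), ξ ≠ 0 → φ (r • ξ) = r ^ a * φ ξ)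
    (h : MaximalEstimate φ (Metric.ball 0 1) s) :
    LocalBound (fun ξ => φ ((2 * Real.pi) • ξ)) s (fun g => g) := by
  intro m hm
  obtain ⟨C, hC⟩ := h
  obtain ⟨K, hK⟩ := hm.exists_bracket_bound hs
  set P : ℝ≥0∞ := ENNReal.ofReal ((2 * Real.pi) ^ (-(n : ℝ) / 2)) with hP
  have hP0 : P ≠ 0 := by
    rw [hP]
    simpa using Real.rpow_pos_of_pos (by positivity) _
  have hPt : P ≠ ⊤ := ENNReal.ofReal_ne_top
  refine ⟨C * P⁻¹.toNNReal * K, fun μ hμ g => ?_⟩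
  have hμ0 : 0 < μ := by linarith
  have hcut := hm.comp_smul (inv_ne_zero hμ0.ne')
  set f := SchwartzMap.fourierMultiplierCLM ℂ (fun ξ => m (μ⁻¹ • ξ)) g with hf
  have h1 : sobolevNorm s f ≤ P⁻¹ * (K * ENNReal.ofReal (μ ^ s) * eLpNorm g 2 volume) := by
    rw [mul_comm, ← div_eq_mul_inv, ENNReal.le_div_iff_mul_le (Or.inl hP0) (Or.inl hPt), mul_comm,
      ← sobolevNorm_eq, ← eLpNorm_fourier g, ← ENNReal.ofReal_coe_nnreal,
      ← ENNReal.ofReal_mul K.coe_nonneg]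
    refine eLpNorm_le_mul_eLpNorm_of_ae_le_mul (ae_of_all _ fun ξ => ?_) 2
    rw [hf, SchwartzMap.fourierMultiplierCLM_apply, fourier_fourierInv_eq,
      SchwartzMap.smulLeftCLM_apply_apply hcut.hasTemperateGrowth, smul_eq_mul, norm_mul, norm_mul,
      Complex.norm_real, Real.norm_of_nonneg (r := bracket ξ ^ s)
        (Real.rpow_nonneg (zero_le_one.trans (one_le_bracket ξ)) _), ← mul_assoc]
    exact mul_le_mul_of_nonneg_right (hK μ hμ ξ) (norm_nonneg _)
  have h2 (x : EuclideanSpace ℝ (Fin n)) :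
      maxOp (phaseSymbol (fun ξ => φ ((2 * Real.pi) • ξ)) m μ) g x ≤ maximalFn φ f x := by
    refine iSup₂_le fun t ht => ?_
    -- The phase `t μ ψ(ξ/μ)` is the original evolution at time `t μ^(1-a)`, still in `(0, 1)`
    -- because `a ≥ 1`.
    have ht' : t * μ ^ (1 - a) ∈ Ioo (0 : ℝ) 1 := by
      have e1 : μ ^ (1 - a) ≤ 1 := Real.rpow_le_one_of_one_le_of_nonpos hμ (by linarith)
      have e2 : 0 < μ ^ (1 - a) := Real.rpow_pos_of_pos hμ0 _
      exact ⟨mul_pos ht.1 e2, by nlinarith [ht.1, ht.2]⟩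
    have h3 : ‖T φ (t * μ ^ (1 - a)) f x‖ₑ ≤ maximalFn φ f x :=
      le_iSup₂ (f := fun t (_ : t ∈ Ioo (0 : ℝ) 1) => ‖T φ t f x‖ₑ) _ ht'
    refine le_trans ?_ h3
    have h4 : phaseSymbol (fun ξ => φ ((2 * Real.pi) • ξ)) m μ t = fun ξ =>
        Complex.exp (Complex.I * ((t * μ ^ (1 - a) * φ ((2 * Real.pi) • ξ) : ℝ) : ℂ)) *
          m (μ⁻¹ • ξ) := by
      ext ξ
      rcases eq_or_ne ξ 0 with rfl | hξ
      · simp [phaseSymbol, hm.eventually_eq_zero.self_of_nhds]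
      · have h5 : (2 * Real.pi) • ξ ≠ 0 := smul_ne_zero (by positivity) hξ
        rw [phaseSymbol, smul_comm, hhom _ (by positivity) _ h5, Real.rpow_sub hμ0, Real.rpow_one,
          Real.inv_rpow hμ0.le]
        congr 4
        ring
    rw [h4, T_eq_multiplier, hf, multiplier_fourierMultiplierCLM _ hcut.hasTemperateGrowth,
      enorm_mul]
    refine le_mul_of_one_le_left' ?_
    rw [← ofReal_norm, Complex.norm_real, Real.norm_of_nonneg (by positivity),
      ENNReal.one_le_ofReal]
    exact one_le_pow₀ (by linarith [Real.pi_gt_three])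
  refine (eLpNorm_mono_enorm (g := maximalFn φ f) fun x => by simpa using h2 x).trans ?_
  refine (hC f).trans ((mul_le_mul' le_rfl h1).trans_eq ?_)
  push_cast
  rw [ENNReal.coe_toNNReal (ENNReal.inv_ne_top.2 hP0)]
  ring

end Transfer

end MaximalTransference

end

theorem mainTheorem1 (n : ℕ) (hn : 1 ≤ n) (a : ℝ) (ha : 1 ≤ a)
    (φ : EuclideanSpace ℝ (Fin n) → ℝ)
    (hφ_hom : ∀ r : ℝ, 0 < r → ∀ ξ : EuclideanSpace ℝ (Fin n), ξ ≠ 0 → φ (r • ξ) = r ^ a * φ ξ)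
    (hφ_smooth : ContDiffOn ℝ ∞ φ {0}ᶜ)
    (hφ_deriv : ∀ (k : ℕ) (i : Fin k → Fin n), ∃ C : ℝ, ∀ ξ : EuclideanSpace ℝ (Fin n), ξ ≠ 0 →
      |MaximalTransference.partialDeriv i φ ξ| ≤ C * ‖ξ‖ ^ (a - (k : ℝ)))
    (hφ_grad : ∃ m : ℝ, 0 < m ∧ ∀ ξ : EuclideanSpace ℝ (Fin n), ‖ξ‖ = 1 → m ≤ ‖gradient φ ξ‖)
    (s₀ : ℝ) (hs₀ : 0 < s₀)
    (hlocal : ∀ s : ℝ, s₀ < s →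
      MaximalTransference.MaximalEstimate φ (Metric.ball (0 : EuclideanSpace ℝ (Fin n)) 1) s) :
    ∀ s : ℝ, a * s₀ < s → MaximalTransference.MaximalEstimate φ Set.univ s := by
  intro s hs
  have ha0 : 0 < a := by linarith
  have h1 : s₀ < s / a := by rwa [lt_div_iff₀ ha0, mul_comm]
  -- The midpoint of `s₀` and `s/a` is admissible locally and leaves a strictly negative exponent
  -- for the geometric series.
  have h2 : s₀ < (s₀ + s / a) / 2 := by linarith
  have h3 : a * ((s₀ + s / a) / 2) < s := by
    have : a * (s / a) = s := mul_div_cancel₀ s ha0.ne'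
    nlinarith
  have hs0 : 0 < s := (mul_pos ha0 hs₀).trans hs
  have hloc := (hlocal _ h2).localBound ha (hs₀.trans h2) hφ_hom
  have hpi : (2 * Real.pi) ≠ 0 := by positivity
  have hψ : ContDiffOn ℝ ∞ (fun ξ : EuclideanSpace ℝ (Fin n) => φ ((2 * Real.pi) • ξ)) {0}ᶜ :=
    hφ_smooth.comp (contDiff_const_smul _).contDiffOn fun ξ hξ => smul_ne_zero hpi hξ
  obtain ⟨C, hC⟩ := MaximalTransference.exists_global_bound hψ ha hs0
    (fun r hr ξ hξ => by
      rw [smul_comm]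
      exact hφ_hom r hr _ (smul_ne_zero hpi hξ)) hloc h3
  refine ⟨((2 * Real.pi) ^ n).toNNReal * C * ((2 * Real.pi) ^ (-(n : ℝ) / 2)).toNNReal,
    fun f => ?_⟩
  have hf := hC f
  rw [MaximalTransference.sobolevNorm_eq] at hf
  rw [Measure.restrict_univ, MaximalTransference.maximalFn_eq,
    MaximalTransference.eLpNorm_two_const_mul _ ENNReal.ofReal_ne_top]
  refine (mul_le_mul' le_rfl hf).trans_eq ?_
  push_cast
  simp only [ENNReal.ofReal]
  ring
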